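/- **Setting.** There are $K\ge 1$ arms and $M\ge 2$ hypotheses. Observations from arm $i$ are real, with density $f_i(x\mid\eta_i)=h_i(x)\exp(\eta_i^T T_i(x)-\mathcal A_i(\eta_i))$ with respect to a $\sigma$-finite measure (e.g. Lebesgue or counting measure), where $\eta_i$ lies in an open convex set $\Psi_i\subset\mathbb R^{d_i}$ and the log-partition function $\mathcal A_i$ is strictly convex and $C^2$ on $\Psi_i$. Under hypothesis $m$, $\overline\eta=(\eta_1,\dots,\eta_K)\in\Theta_m\subset\prod_i\Psi_i$, where $\Theta_1,\dots,\Theta_M$ are nonempty, pairwise disjoint and relatively open (open in their affine hulls). After samples $x^n$ from arms $a^n$, let $f(x^n\mid a^n,\overline\eta)=\prod_{t\le n} f_{a_t}(x_t\mid\eta_{a_t})$, let $N_i^n$ be the number of samples of arm $i$, $Y_i^n=\sum_{t\le n,\,a_t=i}T_i(x_t)$, $w_i=N_i^n/n$ and $\hat\kappa_i=Y_i^n/N_i^n$. Let $\hat f_m=\sup_{\overline\eta\in\Theta_m}f(x^n\mid a^n,\overline\eta)$ be the maximum likelihood function, and let $\tilde f_l=\int_{\Theta_l}f(x^n\mid a^n,\overline\eta)\,p_l(\overline\eta)\,d\overline\eta$,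 where $p_l$ is the conjugate prior, i.e. the probability density on $\Theta_l$ (with respect to Lebesgue measure on its affine hull) proportional to $\prod_i\exp(\eta_i^T\Upsilon_i-n_{0i}\mathcal A_i(\eta_i))$; the hyper-parameters $\Upsilon_i,n_{0i}$ are such that this function is integrable over every $\Theta_l$. Put $Z_l(n)=\min_{m\ne l}\log(\tilde f_l/\hat f_m)$ (with $\log(\tilde f_l/\hat f_m)=-\infty$ if $\hat f_m=\infty$). Let $\overline\eta^*(m)\in\Theta_m$ be a measurable maximum likelihood estimate: a maximiser over $\Theta_m$ of $\sum_i w_i(\eta_i^T\hat\kappa_i-\mathcal A_i(\eta_i))$ if there is one, and otherwise a point whose value is within $\varepsilon_n$ of the supremum if that is finite ($\varepsilon_n\to0$). Let $\lambda^*(\cdot)$ be a measurable selection such that, for $\overline\eta\in\Theta_l$, $\lambda^*(\overline\eta)$ maximises $\inf_{\overline\eta'\in\bigcup_{m\neq l}\Theta_m}\sum_i\lambda_iD(\eta_i\|\eta_i')$ over all probability vectors $\lambda$ on the arms, where $D$ is relative entropy. **The policy $\pi_{SMF}(L,\gamma,\beta)$**, with $0<\gamma\le1$ and $1/2<\beta<1$.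 Sample arm $1$ at time $1$ (this counts as an active sample). For $n=1,2,\dots$: let $l^*\in\arg\max_lZ_l(n)$. If $Z_{l^*}(n)\ge\log((M-1)L)$, stop and declare $\delta=l^*$. Otherwise toss an independent coin $U_{n+1}\sim\mathrm{Bern}(\gamma)$. If $U_{n+1}=0$, sample the current arm again. If $U_{n+1}=1$, sample actively: let $n^a$ be the number of active samples including this one and $N_i^{n,a}$ the number of earlier active samples of arm $i$, and choose an arm in $\arg\min_iN_i^{n,a}$ if $N_i^{n,a}<(n^a)^\beta-(\beta K)^{\beta/(1-\beta)}$ for some $i$, and in $\arg\max_i\{n^a\lambda^*_i(\overline\eta^*(l^*))-N_i^{n,a}\}$ otherwise. All ties are resolved uniformly at random. **Proposition 4.** Let $\alpha>0$, $0<\gamma\le1$, $1/2<\beta<1$ and consider $\pi_{SMF}(1/\alpha,\gamma,\beta)$. 1. For every $l$ and every $\overline\eta\in\Theta_l$, the probability under $\overline\eta$ that the policy stops and declares some $m\ne l$ is at most $\alpha$. 2. If moreover the hypotheses are separated, i.e. no point of $\Theta_l$ is a limit of points of $\Theta_m$ for $l\ne m$, then $\pi_{SMF}(1/\alpha,\gamma,\beta)$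 is admissible: it is a measurable policy, and $P(\delta\neq l\mid\overline\eta)\le\alpha$ for every $l$ and every $\overline\eta\in\Theta_l$, where the event $\delta\ne l$ includes the event that the policy never stops. -/

import Mathlib

open MeasureTheory Filter Topology
open scoped ENNReal unitInterval RealInnerProductSpace

noncomputable section

namespace SMF

/-! ### Vector exponential families -/

/-- The log-partition function `A(η) = log ∫ h(x) exp(ηᵀ T(x)) dν(x)`. -/
def logPartition {d : ℕ} (ν : Measure ℝ) (h : ℝ → ℝ) (T : ℝ → EuclideanSpace ℝ (Fin d))
    (η : EuclideanSpace ℝ (Fin d)) : ℝ :=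
  Real.log (∫ x, h x * Real.exp ⟪η, T x⟫ ∂ν)

/-- A (minimal, regular) vector exponential family of distributions on `ℝ`, with densities
`h(x) exp(ηᵀ T(x) - A(η))` with respect to a `σ`-finite measure `ν` (Lebesgue measure for
probability density functions, a counting measure for probability mass functions), and natural
parameter `η` in an open convex set `Ψ`. -/
structure ExpFamily (d : ℕ) where
  /-- the dominating measure -/
  ν : Measure ℝ
  sigmaFinite : SigmaFinite ν
  /-- the carrier density -/
  h : ℝ → ℝ
  /-- the sufficient statistic -/
  T : ℝ → EuclideanSpace ℝ (Fin d)
  /-- the set of natural parameters -/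
  Ψ : Set (EuclideanSpace ℝ (Fin d))
  measurable_h : Measurable h
  nonneg_h : ∀ x, 0 ≤ h x
  measurable_T : Measurable T
  isOpen_Ψ : IsOpen Ψ
  convex_Ψ : Convex ℝ Ψ
  integrable : ∀ η ∈ Ψ, Integrable (fun x => h x * Real.exp ⟪η, T x⟫) ν
  integral_pos : ∀ η ∈ Ψ, 0 < ∫ x, h x * Real.exp ⟪η, T x⟫ ∂ν
  strictConvexOn_A : StrictConvexOn ℝ Ψ (logPartition ν h T)
  contDiffOn_A : ContDiffOn ℝ 2 (logPartition ν h T) Ψ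

namespace ExpFamily

variable {d : ℕ}

/-- The log-partition function of the family. -/
def A (𝓔 : ExpFamily d) (η : EuclideanSpace ℝ (Fin d)) : ℝ := logPartition 𝓔.ν 𝓔.h 𝓔.T η

/-- The density `f(x | η)`. -/
def density (𝓔 : ExpFamily d) (η : EuclideanSpace ℝ (Fin d)) (x : ℝ) : ℝ :=
  𝓔.h x * Real.exp (⟪η, 𝓔.T x⟫ - 𝓔.A η)

/-- The distribution with density `f(· | η)`. -/
def law (𝓔 : ExpFamily d) (η : EuclideanSpace ℝ (Fin d)) : Measure ℝ :=
  𝓔.ν.withDensity fun x => ENNReal.ofReal (𝓔.density η x)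

theorem isProbabilityMeasure_law (𝓔 : ExpFamily d) {η : EuclideanSpace ℝ (Fin d)}
    (hη : η ∈ 𝓔.Ψ) : IsProbabilityMeasure (𝓔.law η) := by
  have hpos := 𝓔.integral_pos η hη
  have hdens : 𝓔.density η = fun x =>
      (∫ y, 𝓔.h y * Real.exp ⟪η, 𝓔.T y⟫ ∂𝓔.ν)⁻¹ * (𝓔.h x * Real.exp ⟪η, 𝓔.T x⟫) := by
    funext x
    rw [density, A, logPartition, Real.exp_sub, Real.exp_log hpos]
    ring
  have hint : Integrable (𝓔.density η) 𝓔.ν := by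
    rw [hdens]; exact (𝓔.integrable η hη).const_mul _
  have hnn : ∀ x, 0 ≤ 𝓔.density η x := fun x =>
    mul_nonneg (𝓔.nonneg_h x) (Real.exp_pos _).le
  constructor
  rw [law, withDensity_apply _ MeasurableSet.univ, Measure.restrict_univ,
    ← ofReal_integral_eq_lintegral_ofReal hint (Filter.Eventually.of_forall hnn), hdens,
    integral_const_mul, inv_mul_cancel₀ hpos.ne', ENNReal.ofReal_one]

end ExpFamily

/-! ### The multi-hypothesis testing problem for a `K`-armed bandit -/

/-- Tuples `(η₁, …, η_K)` of parameters, one for each arm. -/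
abbrev Param {K : ℕ} (d : Fin K → ℕ) : Type := ∀ i, EuclideanSpace ℝ (Fin (d i))

/-- The problem: `K` arms, each with an exponential family, and `M` hypotheses, the `m`-th one
saying that the tuple of parameters lies in `Θ m`. The sets `Θ m` are disjoint and relatively
open (equal to their relative interior). -/
structure Problem (K M : ℕ) (d : Fin K → ℕ) where
  arm : ∀ i, ExpFamily (d i)
  Θ : Fin M → Set (Param d)
  mem_Ψ : ∀ m, ∀ η ∈ Θ m, ∀ i, η i ∈ (arm i).Ψ
  nonempty_Θ : ∀ m, (Θ m).Nonempty
  disjoint_Θ : ∀ l m, l ≠ m → Disjoint (Θ l) (Θ m)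
  relOpen_Θ : ∀ m, intrinsicInterior ℝ (Θ m) = Θ m

/-- No parameter of a hypothesis is a limit of parameters of another hypothesis. -/
def Problem.Separated {K M : ℕ} {d : Fin K → ℕ} (𝓑 : Problem K M d) : Prop :=
  ∀ l m, l ≠ m → Disjoint (𝓑.Θ l) (closure (𝓑.Θ m))

/-! ### Policies, stopping, decisions and false detection -/

/-- An action: stop and decide for a hypothesis, or continue and sample an arm. -/
inductive Action (K M : ℕ) where
  | halt (δ : Fin M)
  | sample (i : Fin K)

/-- The declared hypothesis, `none` (null) if the action is to continue. -/
def Action.decision? {K M : ℕ} : Action K M → Option (Fin M)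
  | halt δ => some δ
  | sample _ => none

/-- The arm that is sampled (with a dummy value after the policy has stopped). -/
def Action.arm {K M : ℕ} [NeZero K] : Action K M → Fin K
  | halt _ => 0
  | sample i => i

/-- A (randomised) policy. At each stage an independent seed of law `seedLaw` is drawn, and the
action after `n` samples is a function of the seeds drawn up to then (the fresh one included),
of the arms `a` sampled so far and of the observations `x` so far. -/
structure Policy (K M : ℕ) where
  Seed : Type
  measurableSpace : MeasurableSpace Seed
  seedLaw : Measure Seed
  isProbabilityMeasure : IsProbabilityMeasure seedLaw
  act : (n : ℕ) → (Fin (n + 1) → Seed) → (Fin n → Fin K) → (Fin n → ℝ) → Action K M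

namespace Policy

variable {K M : ℕ}

instance (π : Policy K M) : MeasurableSpace π.Seed := π.measurableSpace

instance (π : Policy K M) : IsProbabilityMeasure π.seedLaw := π.isProbabilityMeasure

/-- The actions of the policy are measurable functions of the seeds and the observations. -/
def IsMeasurable (π : Policy K M) : Prop :=
  ∀ (n : ℕ) (a : Fin n → Fin K) (c : Action K M),
    MeasurableSet {p : (Fin (n + 1) → π.Seed) × (Fin n → ℝ) | π.act n p.1 a p.2 = c}

/-- A sample point: for each time, the seed of the policy and, for each arm, the value that is
observed if this arm is the one sampled at that time. -/
abbrev Outcome (π : Policy K M) : Type := ℕ → π.Seed × (Fin K → ℝ)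

/-- The probability `P(· | η)` on sample points: seeds and observations are independent, over
time and over arms, and observations from arm `i` have density `f(· | ηᵢ)`. -/
def prob {d : Fin K → ℕ} (π : Policy K M) (𝓑 : Problem K M d) (η : Param d) :
    Measure π.Outcome :=
  Measure.infinitePi fun _ => π.seedLaw.prod (Measure.pi fun i => (𝓑.arm i).law (η i))

theorem isProbabilityMeasure_prob {d : Fin K → ℕ} (π : Policy K M) (𝓑 : Problem K M d)
    {η : Param d} {l : Fin M} (hη : η ∈ 𝓑.Θ l) : IsProbabilityMeasure (π.prob 𝓑 η) := by
  have := fun i => (𝓑.arm i).isProbabilityMeasure_law (𝓑.mem_Ψ l η hη i)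
  unfold prob
  infer_instance

variable [NeZero K]

/-- The arms sampled at the first `n` instants. -/
def arms (π : Policy K M) (ω : π.Outcome) : (n : ℕ) → Fin n → Fin K
  | 0 => Fin.elim0
  | n + 1 => Fin.snoc (α := fun _ => Fin K) (π.arms ω n)
      (π.act n (fun t => (ω t).1) (π.arms ω n) (fun t => (ω t).2 (π.arms ω n t))).arm

/-- The action after `n` samples. -/
def action (π : Policy K M) (ω : π.Outcome) (n : ℕ) : Action K M :=
  π.act n (fun t => (ω t).1) (π.arms ω n) (fun t => (ω t).2 (π.arms ω n t))

open Classical in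
/-- The decision made when the policy stops for the first time; `none` if it never stops. -/
def decision (π : Policy K M) (ω : π.Outcome) : Option (Fin M) :=
  if h : ∃ n, (π.action ω n).decision? ≠ none then
    (π.action ω (Nat.find h)).decision?
  else none

end Policy

/-- The set `Π(α)` of admissible policies: `P(δ ≠ l | η) ≤ α` for all `l` and all `η ∈ Θ l`,
where a policy that never stops makes no decision, so that then `δ ≠ l`. -/
def Admissible {K M : ℕ} [NeZero K] {d : Fin K → ℕ} (𝓑 : Problem K M d) (α : ℝ) :
    Set (Policy K M) :=
  {π | π.IsMeasurable ∧ ∀ l, ∀ η ∈ 𝓑.Θ l,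
    π.prob 𝓑 η {ω | π.decision ω ≠ some l} ≤ ENNReal.ofReal α}

/-! ### Likelihoods and the modified GLR statistic -/

/-- `N_i^n`, the number of times that arm `i` was sampled. -/
def sampleCount {K n : ℕ} (a : Fin n → Fin K) (i : Fin K) : ℕ :=
  (Finset.univ.filter fun t => a t = i).card

/-- The Lebesgue measure on the affine hull of a nonempty set `S` in a finite-dimensional space
(up to a normalisation, which cancels in all normalised priors). -/
def affineLebesgue {E : Type*} [NormedAddCommGroup E] [NormedSpace ℝ E] [FiniteDimensional ℝ E]
    [MeasurableSpace E] [BorelSpace E] (S : Set E) : Measure E :=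
  open Classical in
  if h : S.Nonempty then
    (Module.finBasis ℝ (vectorSpan ℝ S)).addHaar.map fun v : vectorSpan ℝ S => (v : E) + h.some
  else 0

namespace Problem

variable {K M : ℕ} {d : Fin K → ℕ} (𝓑 : Problem K M d)

/-- `Y_i^n`, the sum of the sufficient statistic over the observations from arm `i`. -/
def statSum {n : ℕ} (a : Fin n → Fin K) (x : Fin n → ℝ) (i : Fin K) :
    EuclideanSpace ℝ (Fin (d i)) :=
  ∑ t, if a t = i then (𝓑.arm i).T (x t) else 0

/-- The likelihood `f(xⁿ | aⁿ, η)`. -/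
def likelihood {n : ℕ} (a : Fin n → Fin K) (x : Fin n → ℝ) (η : Param d) : ℝ :=
  ∏ t, (𝓑.arm (a t)).density (η (a t)) (x t)

/-- The function `∑ᵢ wᵢ (ηᵢᵀ κ̂ᵢ - Aᵢ(ηᵢ))`, with `wᵢ = N_i^n / n` and `κ̂ᵢ = Y_i^n / N_i^n`,
whose maximisers are the maximum likelihood estimates. -/
def normLogLik {n : ℕ} (a : Fin n → Fin K) (x : Fin n → ℝ) (η : Param d) : ℝ :=
  ∑ i, ((sampleCount a i : ℝ) / n) *
    (⟪η i, (sampleCount a i : ℝ)⁻¹ • 𝓑.statSum a x i⟫ - (𝓑.arm i).A (η i))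

/-- The maximum likelihood function of hypothesis `m`, the largest value (supremum) of the
likelihood over `Θ m`. -/
def maxLikelihood {n : ℕ} (a : Fin n → Fin K) (x : Fin n → ℝ) (m : Fin M) : ℝ≥0∞ :=
  ⨆ η ∈ 𝓑.Θ m, ENNReal.ofReal (𝓑.likelihood a x η)

/-- The unnormalised conjugate prior with hyper-parameters `Υ`, `n₀`. -/
def priorKernel (Υ : Param d) (n₀ : Fin K → ℝ) (η : Param d) : ℝ≥0∞ :=
  ENNReal.ofReal (∏ i, Real.exp (⟪η i, Υ i⟫ - n₀ i * (𝓑.arm i).A (η i)))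

/-- The total mass over `Θ l` of the unnormalised conjugate prior. -/
def priorMass (Υ : Param d) (n₀ : Fin K → ℝ) (l : Fin M) : ℝ≥0∞ :=
  ∫⁻ η in 𝓑.Θ l, 𝓑.priorKernel Υ n₀ η ∂(affineLebesgue (𝓑.Θ l))

/-- The conjugate priors are proper: they can be normalised to probability densities. -/
def IsProperPrior (Υ : Param d) (n₀ : Fin K → ℝ) : Prop :=
  ∀ l, 𝓑.priorMass Υ n₀ l < ∞

/-- The likelihood averaged over `Θ l` with respect to the normalised conjugate prior. -/
def avgLikelihood (Υ : Param d) (n₀ : Fin K → ℝ) {n : ℕ} (a : Fin n → Fin K) (x : Fin n → ℝ)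
    (l : Fin M) : ℝ≥0∞ :=
  ∫⁻ η in 𝓑.Θ l, ENNReal.ofReal (𝓑.likelihood a x η) *
    ((𝓑.priorMass Υ n₀ l)⁻¹ * 𝓑.priorKernel Υ n₀ η) ∂(affineLebesgue (𝓑.Θ l))

/-- The modified GLR `Z_{lm}(n)` of hypothesis `l` against hypothesis `m`. -/
def pairGLR (Υ : Param d) (n₀ : Fin K → ℝ) {n : ℕ} (a : Fin n → Fin K) (x : Fin n → ℝ)
    (l m : Fin M) : EReal :=
  ENNReal.log (𝓑.avgLikelihood Υ n₀ a x l / 𝓑.maxLikelihood a x m)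

/-- The modified GLR `Z_l(n)` of hypothesis `l` against its nearest alternative. -/
def modGLR (Υ : Param d) (n₀ : Fin K → ℝ) {n : ℕ} (a : Fin n → Fin K) (x : Fin n → ℝ)
    (l : Fin M) : EReal :=
  ⨅ m : {m : Fin M // m ≠ l}, 𝓑.pairGLR Υ n₀ a x l m

/-! ### Parameter estimates and optimal sampling distributions -/

/-- `est n a x m` is the maximum likelihood estimate of the parameters under hypothesis `m`, a
point of `Θ m` at which the maximum over `Θ m` is attained if there is one, and otherwise one
whose value is within `ε n` of the supremum if that is finite; here `ε n → 0`. The estimates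
depend measurably on the observations. -/
structure IsMLE (ε : ℕ → ℝ)
    (est : (n : ℕ) → (Fin n → Fin K) → (Fin n → ℝ) → Fin M → Param d) : Prop where
  tendsto : Tendsto ε atTop (𝓝 0)
  measurable : ∀ n a m, Measurable fun x => est n a x m
  mem : ∀ n a x m, est n a x m ∈ 𝓑.Θ m
  attained : ∀ n a x m, (∃ η ∈ 𝓑.Θ m, IsMaxOn (𝓑.normLogLik a x) (𝓑.Θ m) η) →
    IsMaxOn (𝓑.normLogLik a x) (𝓑.Θ m) (est n a x m)
  approx : ∀ n a x m, (¬ ∃ η ∈ 𝓑.Θ m, IsMaxOn (𝓑.normLogLik a x) (𝓑.Θ m) η) →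
    BddAbove (𝓑.normLogLik a x '' 𝓑.Θ m) →
    |sSup (𝓑.normLogLik a x '' 𝓑.Θ m) - 𝓑.normLogLik a x (est n a x m)| ≤ ε n

/-- `inf_{η' ∈ Θ_{-l}} ∑ᵢ λᵢ D(ηᵢ ‖ ηᵢ')`, where `Θ_{-l}` is the union of the other
hypotheses. -/
def infoRate (l : Fin M) (η : Param d) (w : Fin K → ℝ) : ℝ≥0∞ :=
  ⨅ η' ∈ (⋃ m, 𝓑.Θ m) \ 𝓑.Θ l,
    ∑ i, ENNReal.ofReal (w i) *
      InformationTheory.klDiv ((𝓑.arm i).law (η i)) ((𝓑.arm i).law (η' i))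

/-- `lam` is a measurable selection of a sampling distribution `λ*(η)` that maximises
`inf_{η' ∈ Θ_{-l}} ∑ᵢ λᵢ D(ηᵢ ‖ ηᵢ')` over all probability vectors `λ`, for `η ∈ Θ l`. -/
structure IsOptimalSampling (lam : Param d → Fin K → ℝ) : Prop where
  measurable : Measurable lam
  mem : ∀ l, ∀ η ∈ 𝓑.Θ l, lam η ∈ stdSimplex ℝ (Fin K)
  isMaxOn : ∀ l, ∀ η ∈ 𝓑.Θ l, IsMaxOn (𝓑.infoRate l η) (stdSimplex ℝ (Fin K)) (lam η)

end Problem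

/-! ### The policy -/

/-- The set of maximisers of a function on a finite nonempty type. -/
def argmaxSet {ι β : Type*} [Fintype ι] [Nonempty ι] [LinearOrder β] (f : ι → β) :
    {S : Finset ι // S.Nonempty} :=
  ⟨Finset.univ.filter fun i => ∀ j, f j ≤ f i, by
    obtain ⟨i, -, hi⟩ := Finset.exists_max_image Finset.univ f Finset.univ_nonempty
    exact ⟨i, by simpa using hi⟩⟩

/-- The set of minimisers of a function on a finite nonempty type. -/
def argminSet {ι β : Type*} [Fintype ι] [Nonempty ι] [LinearOrder β] (f : ι → β) :
    {S : Finset ι // S.Nonempty} :=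
  argmaxSet fun i => OrderDual.toDual (f i)

/-- The seed of a random tie-break: an element for each nonempty set of tied candidates. -/
abbrev TieBreak (k : ℕ) : Type := {S : Finset (Fin k) // S.Nonempty} → Fin k

/-- For each nonempty set of tied candidates, an element of it is drawn uniformly at random. -/
def tieBreakLaw (k : ℕ) : Measure (TieBreak k) :=
  Measure.pi fun S => (PMF.uniformOfFinset S.1 S.2).toMeasure

instance (k : ℕ) : IsProbabilityMeasure (tieBreakLaw k) := by
  unfold tieBreakLaw; infer_instance

/-- The seed of a stage: the coin `U`, the tie-break for the hypothesis `l*` and the tie-break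
for the next arm. -/
abbrev StageSeed (K M : ℕ) : Type := Bool × TieBreak M × TieBreak K

/-- Coin of bias `γ` and uniform tie-breaks, all independent. -/
def stageSeedLaw (K M : ℕ) (γ : I) : Measure (StageSeed K M) :=
  (ProbabilityTheory.bernoulliMeasure true false γ).prod
    ((tieBreakLaw M).prod (tieBreakLaw K))

instance (K M : ℕ) (γ : I) : IsProbabilityMeasure (stageSeedLaw K M γ) := by
  unfold stageSeedLaw; infer_instance

/-- The instants (among the first `n`) of active sampling: the first one, and those for which the
coin showed `1`. -/
def activeTimes {K M n : ℕ} (s : Fin (n + 1) → StageSeed K M) : Finset (Fin n) :=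
  Finset.univ.filter fun t => (t : ℕ) = 0 ∨ (s t.castSucc).1 = true

/-- `N_i^{n,a}`, the number of times that arm `i` was sampled actively. -/
def activeCount {K M n : ℕ} (s : Fin (n + 1) → StageSeed K M) (a : Fin n → Fin K) (i : Fin K) :
    ℕ :=
  ((activeTimes s).filter fun t => a t = i).card

open Classical in
/-- The sampling rule for active sampling, with forced exploration; `na` is the number of active
instants including the present one, `N` are the numbers of earlier active samples of the arms,
`w` is the target sampling distribution, and `ξ` is the tie-break. -/
def trackingArm {K : ℕ} [NeZero K] (β : ℝ) (na : ℕ) (N : Fin K → ℕ) (w : Fin K → ℝ)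
    (ξ : TieBreak K) : Fin K :=
  if ∃ i, (N i : ℝ) < (na : ℝ) ^ β - (β * K) ^ (β / (1 - β)) then
    ξ (argminSet N)
  else
    ξ (argmaxSet fun i => na * w i - N i)

open Classical in
/-- The policy `π_SMF(L, γ, β)`, with prior hyper-parameters `Υ`, `n₀`, parameter estimates `est`
and sampling distributions `lam`. -/
def piSMF {K M : ℕ} [NeZero K] [NeZero M] {d : Fin K → ℕ} (𝓑 : Problem K M d)
    (Υ : Param d) (n₀ : Fin K → ℝ)
    (est : (n : ℕ) → (Fin n → Fin K) → (Fin n → ℝ) → Fin M → Param d)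
    (lam : Param d → Fin K → ℝ) (L : ℝ) (γ : I) (β : ℝ) : Policy K M where
  Seed := StageSeed K M
  measurableSpace := inferInstance
  seedLaw := stageSeedLaw K M γ
  isProbabilityMeasure := inferInstance
  act
    | 0, _, _, _ => .sample 0
    | n + 1, s, a, x =>
      let seed := s (Fin.last (n + 1))
      let l := seed.2.1 (argmaxSet (𝓑.modGLR Υ n₀ a x))
      if 𝓑.modGLR Υ n₀ a x l < ((Real.log ((M - 1) * L) : ℝ) : EReal) then
        .sample <|
          if seed.1 = true then
            trackingArm β ((activeTimes s).card + 1) (activeCount s a)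
              (lam (est (n + 1) a x l)) seed.2.2
          else a (Fin.last n)
      else .halt l

end SMF

end

/-! Wrong declarations are controlled by a change of measure. When the policy halts with `m`, the
averaged likelihood of `m` is at least `c = (M - 1) / α` times the likelihood at the true `η`.
Integrating over the event of halting at time `n` bounds `c` times its probability under `η` by its
probability under the prior mixture over `Θ m`. These events are disjoint in `n`, so the sum of the
mixture probabilities is at most one, and each wrong `m` costs at most `α / (M - 1)`. The lemmas are
`Policy.mul_prob_le_lintegral_prob` and `mul_prob_decision_le_one`; a union bound over the wrong
hypotheses finishes the first claim.

For the second claim it remains to see that the policy stops almost surely (`ae_decision_ne_none`).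
Fix `1/2 < θ < b < β` and suppose that it never stops. The coin shows `1` with positive frequency,
so forced exploration gives every arm at least `n ^ b` samples eventually
(`eventually_rpow_le_sampleCount`, from the counting argument `le_card_of_greedy`). The centred
sufficient statistics are eventually at most `n ^ θ` (`ae_eventually_norm_noise_le`); this again
comes from a change of measure, to a parameter at distance `n ^ (-1/2)`, and from Borel-Cantelli. By
`likelihood_eq_noise` the log-likelihood ratio is linear in the noise minus sample counts times
Bregman divergences. Hence averaging over a ball of radius `1 / n` loses only a factor `exp (-O(n ^
θ))` against the likelihood at `η`, while every separated hypothesis has maximum likelihood smaller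
by `exp (O(n ^ θ) - const * n ^ b)`. The statistic of the true hypothesis therefore crosses every
threshold, and so does that of the leader, a contradiction. -/

namespace SMF

/-! ### Finite products of measures with densities -/

theorem lintegral_pi_fin_prod {n : ℕ} {X : Fin n → Type*} [∀ t, MeasurableSpace (X t)]
    (ν : ∀ t, Measure (X t)) [∀ t, SigmaFinite (ν t)] (f : ∀ t, X t → ℝ≥0∞)
    (hf : ∀ t, Measurable (f t)) :
    ∫⁻ x, ∏ t, f t (x t) ∂Measure.pi ν = ∏ t, ∫⁻ x, f t x ∂ν t := by
  induction n with
  | zero => simp [lintegral_const]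
  | succ n ih =>
    rw [Fin.prod_univ_succ, ← ih (fun t => ν t.succ) (fun t => f t.succ) (fun t => hf _),
      ← lintegral_prod_mul (g := fun y : ∀ t : Fin n, X t.succ => ∏ t, f t.succ (y t))
        (hf 0).aemeasurable (Finset.measurable_fun_prod _ fun t _ =>
          (hf t.succ).comp (measurable_pi_apply t)).aemeasurable]
    refine Eq.trans (lintegral_congr fun x => ?_)
      ((measurePreserving_piFinSuccAbove ν 0).lintegral_comp_emb
        (MeasurableEquiv.measurableEmbedding _)
        fun z => f 0 z.1 * ∏ t : Fin n, f t.succ (z.2 t))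
    rw [Fin.prod_univ_succ]
    rfl

theorem pi_withDensity {n : ℕ} (ν : Fin n → Measure ℝ) [∀ t, SigmaFinite (ν t)]
    (f : Fin n → ℝ → ℝ≥0∞) (hf : ∀ t, Measurable (f t))
    [∀ t, SigmaFinite ((ν t).withDensity (f t))] :
    Measure.pi (fun t => (ν t).withDensity (f t)) =
      (Measure.pi ν).withDensity fun x => ∏ t, f t (x t) := by
  refine Measure.pi_eq fun s hs => ?_
  rw [withDensity_apply _ (MeasurableSet.univ_pi hs), ← lintegral_indicator (.univ_pi hs)]
  have : (Set.univ.pi s).indicator (fun x : Fin n → ℝ => ∏ t, f t (x t)) =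
      fun x => ∏ t, (s t).indicator (f t) (x t) := by
    funext x
    by_cases hx : x ∈ Set.univ.pi s
    · rw [Set.indicator_of_mem hx]
      exact Finset.prod_congr rfl fun t _ => (Set.indicator_of_mem (hx t trivial) _).symm
    · rw [Set.indicator_of_notMem hx]
      simp only [Set.mem_pi, Set.mem_univ, true_implies, not_forall] at hx
      obtain ⟨t, ht⟩ := hx
      exact (Finset.prod_eq_zero (Finset.mem_univ t) (Set.indicator_of_notMem ht _)).symm
  rw [this, lintegral_pi_fin_prod _ _ fun t => (hf t).indicator (hs t)]
  refine Finset.prod_congr rfl fun t _ => ?_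
  rw [withDensity_apply _ (hs t), lintegral_indicator (hs t)]

/-! ### Measurability of densities and likelihoods -/

namespace ExpFamily

variable {d : ℕ} (𝓔 : ExpFamily d)

instance : SigmaFinite 𝓔.ν := 𝓔.sigmaFinite

theorem measurable_A : Measurable 𝓔.A := by
  unfold A logPartition
  refine Real.measurable_log.comp ?_
  refine (StronglyMeasurable.integral_prod_right (f := fun (η : EuclideanSpace ℝ (Fin d)) x =>
    𝓔.h x * Real.exp ⟪η, 𝓔.T x⟫) ?_).measurable
  have := 𝓔.measurable_h
  have := 𝓔.measurable_T
  refine Measurable.stronglyMeasurable ?_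
  simp only [Function.uncurry_def]
  fun_prop

@[fun_prop]
theorem measurable_density_uncurry :
    Measurable fun p : EuclideanSpace ℝ (Fin d) × ℝ => 𝓔.density p.1 p.2 := by
  unfold density
  have := 𝓔.measurable_h
  have := 𝓔.measurable_T
  have := 𝓔.measurable_A
  fun_prop

theorem measurable_density (η : EuclideanSpace ℝ (Fin d)) : Measurable (𝓔.density η) := by
  fun_prop

theorem density_nonneg (η : EuclideanSpace ℝ (Fin d)) (x : ℝ) : 0 ≤ 𝓔.density η x :=
  mul_nonneg (𝓔.nonneg_h x) (Real.exp_pos _).le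

end ExpFamily

namespace Problem

variable {K M : ℕ} {d : Fin K → ℕ} (𝓑 : Problem K M d)

/-- The natural parameter space of the tuple of arms. -/
noncomputable def naturalSpace : Set (Param d) := {η | ∀ i, η i ∈ (𝓑.arm i).Ψ}

theorem Θ_subset_naturalSpace (m : Fin M) : 𝓑.Θ m ⊆ 𝓑.naturalSpace := 𝓑.mem_Ψ m

theorem measurable_likelihood_uncurry {n : ℕ} (a : Fin n → Fin K) :
    Measurable fun p : Param d × (Fin n → ℝ) => 𝓑.likelihood a p.2 p.1 := by
  unfold likelihood
  refine Finset.measurable_fun_prod _ fun t _ => ?_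
  exact (𝓑.arm (a t)).measurable_density_uncurry.comp
    (f := fun p : Param d × (Fin n → ℝ) => (p.1 (a t), p.2 t)) (by fun_prop)

theorem likelihood_nonneg {n : ℕ} (a : Fin n → Fin K) (x : Fin n → ℝ) (η : Param d) :
    0 ≤ 𝓑.likelihood a x η :=
  Finset.prod_nonneg fun _ _ => ExpFamily.density_nonneg _ _ _

theorem ofReal_likelihood {n : ℕ} (a : Fin n → Fin K) (x : Fin n → ℝ) (η : Param d) :
    ENNReal.ofReal (𝓑.likelihood a x η) =
      ∏ t, ENNReal.ofReal ((𝓑.arm (a t)).density (η (a t)) (x t)) :=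
  ENNReal.ofReal_prod_of_nonneg fun _ _ => ExpFamily.density_nonneg _ _ _

end Problem

/-! ### Finite-horizon laws of seeds and observations -/

namespace Policy

variable {K M : ℕ} {d : Fin K → ℕ} (π : Policy K M) (𝓑 : Problem K M d)

theorem isProbabilityMeasure_prob_of_mem {η : Param d} (hη : η ∈ 𝓑.naturalSpace) :
    IsProbabilityMeasure (π.prob 𝓑 η) := by
  have := fun i => (𝓑.arm i).isProbabilityMeasure_law (hη i)
  unfold prob
  infer_instance

/-- The seeds up to time `n`, and the first `n` observations if the arms are `a`. -/
noncomputable def observe {n : ℕ} (a : Fin n → Fin K) (ω : π.Outcome) :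
    (Fin (n + 1) → π.Seed) × (Fin n → ℝ) :=
  (fun t => (ω t).1, fun t => (ω t).2 (a t))

theorem measurable_observe {n : ℕ} (a : Fin n → Fin K) : Measurable (π.observe a) := by
  unfold observe; fun_prop

/-- For a fixed arm sequence only one observation coordinate is read at each time, so a rectangle of
observed values pulls back to a cylinder of the infinite product. Rectangles determine the product
measure. -/
theorem map_observe_prob {n : ℕ} (a : Fin n → Fin K) {η : Param d}
    (hη : η ∈ 𝓑.naturalSpace) :
    (π.prob 𝓑 η).map (π.observe a) =
      (Measure.pi fun _ => π.seedLaw).prod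
        (Measure.pi fun t => (𝓑.arm (a t)).law (η (a t))) := by
  have := fun i => (𝓑.arm i).isProbabilityMeasure_law (hη i)
  have := π.isProbabilityMeasure_prob_of_mem 𝓑 hη
  symm
  refine Measure.prod_eq_generateFrom generateFrom_pi generateFrom_pi
    (isPiSystem_pi) (isPiSystem_pi)
    (Measure.FiniteSpanningSetsIn.pi fun _ => Measure.toFiniteSpanningSetsIn _)
    (Measure.FiniteSpanningSetsIn.pi fun _ => Measure.toFiniteSpanningSetsIn _) ?_
  rintro _ ⟨S, hS, rfl⟩ _ ⟨B, hB, rfl⟩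
  simp only [Set.mem_pi, Set.mem_univ, true_implies, Set.mem_ofPred_eq] at hS hB
  rw [Measure.map_apply (π.measurable_observe a)
    ((MeasurableSet.univ_pi hS).prod (.univ_pi hB)), Measure.pi_pi, Measure.pi_pi]
  -- Seeds are constrained up to time `n` inclusive, observations only before `n`: the action at
  -- time `n` uses a fresh seed but no fresh observation.
  let R : ℕ → Set (π.Seed × (Fin K → ℝ)) := fun t =>
    (if h : t < n + 1 then S ⟨t, h⟩ else Set.univ) ×ˢ
      (if h : t < n then Function.eval (a ⟨t, h⟩) ⁻¹' B ⟨t, h⟩ else Set.univ)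
  have hpre : π.observe a ⁻¹' (Set.univ.pi S ×ˢ Set.univ.pi B) =
      (Finset.range (n + 1) : Set ℕ).pi R := by
    ext ω
    simp only [observe, Set.mem_preimage, Set.mem_prod, Set.mem_pi, Set.mem_univ, true_implies,
      Finset.coe_range, Set.mem_Iio, R]
    constructor
    · rintro ⟨h1, h2⟩ t ht
      refine ⟨by simpa [ht] using h1 ⟨t, ht⟩, ?_⟩
      split_ifs with h
      · exact h2 ⟨t, h⟩
      · trivial
    · intro h
      refine ⟨fun t => by simpa [Nat.lt_succ_iff.1 t.2] using (h t t.2).1, fun t => ?_⟩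
      simpa using (h t (t.2.trans n.lt_succ_self)).2
  have hR : ∀ t, MeasurableSet (R t) := by
    intro t
    refine MeasurableSet.prod ?_ ?_
    · split_ifs with h
      · exact hS _
      · exact .univ
    · split_ifs with h
      · exact measurable_pi_apply _ (hB _)
      · exact .univ
  rw [hpre, prob, Measure.infinitePi_pi _ fun t _ => hR t]
  simp only [R, Measure.prod_prod]
  rw [Finset.prod_mul_distrib, Finset.prod_range, Finset.prod_range]
  congr 1
  · exact Finset.prod_congr rfl fun t _ => by simp [Nat.lt_succ_iff.1 t.2]
  · rw [Fin.prod_univ_castSucc]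
    simp only [Fin.val_castSucc, Fin.is_lt, dite_true, Fin.val_last, lt_irrefl, dite_false,
      measure_univ, mul_one, Fin.eta]
    refine Finset.prod_congr rfl fun t _ => ?_
    exact (measurePreserving_eval (fun i => (𝓑.arm i).law (η i)) (a t)).measure_preimage
      (hB t).nullMeasurableSet

/-- The reference measure of the seeds up to time `n` and the first `n` observations. -/
noncomputable def refMeasure {n : ℕ} (a : Fin n → Fin K) : Measure ((Fin (n + 1) → π.Seed) × (Fin n → ℝ)) :=
  (Measure.pi fun _ => π.seedLaw).prod (Measure.pi fun t => (𝓑.arm (a t)).ν)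

instance {n : ℕ} (a : Fin n → Fin K) : SigmaFinite (π.refMeasure 𝓑 a) := by
  unfold refMeasure; infer_instance

/-- One reference measure serves all parameters, so probabilities under different parameters can be
compared through likelihoods alone. -/
theorem map_observe_eq_withDensity {n : ℕ} (a : Fin n → Fin K) {η : Param d}
    (hη : η ∈ 𝓑.naturalSpace) :
    (π.prob 𝓑 η).map (π.observe a) =
      (π.refMeasure 𝓑 a).withDensity fun p => ENNReal.ofReal (𝓑.likelihood a p.2 η) := by
  have : ∀ i, IsProbabilityMeasure ((𝓑.arm i).ν.withDensity
    fun x => ENNReal.ofReal ((𝓑.arm i).density (η i) x)) :=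
      fun i => (𝓑.arm i).isProbabilityMeasure_law (hη i)
  have hm : ∀ i, Measurable fun x => ENNReal.ofReal ((𝓑.arm i).density (η i) x) :=
    fun i => ((𝓑.arm i).measurable_density _).ennreal_ofReal
  rw [π.map_observe_prob 𝓑 a hη, refMeasure]
  simp only [ExpFamily.law, 𝓑.ofReal_likelihood]
  rw [pi_withDensity _ _ fun t => hm (a t), prod_withDensity_right]
  exact Finset.measurable_fun_prod _ fun t _ => (hm _).comp (measurable_pi_apply t)

end Policy

/-- Countability of the actions reduces measurability of sets of actions to single actions. -/
theorem Action.injective_toSum {K M : ℕ} : Function.Injective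
    (fun c : Action K M => (match c with
      | .halt δ => Sum.inl δ
      | .sample i => Sum.inr i : Fin M ⊕ Fin K)) := by
  rintro (_ | _) (_ | _) h <;> simp_all

instance {K M : ℕ} : Countable (Action K M) := Action.injective_toSum.countable

/-! ### Events determined by a finite history, and change of measure -/

namespace Policy

variable {K M : ℕ} {d : Fin K → ℕ} (π : Policy K M) (𝓑 : Problem K M d)

/-- A sample point with given seeds up to time `n` and given first `n` observations. -/
def embed {n : ℕ} (p : (Fin (n + 1) → π.Seed) × (Fin n → ℝ)) : π.Outcome := fun t =>
  -- Seeds after time `n` repeat the last one and missing observations are `0`; neither is visible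
  -- to the history up to `n`. All arms receive the same value, so whichever arm is sampled shows
  -- the recorded observation.
  (p.1 ⟨min t n, Nat.lt_succ_of_le (min_le_right t n)⟩,
    fun _ => if h : t < n then p.2 ⟨t, h⟩ else 0)

theorem measurable_embed {n : ℕ} :
    Measurable (π.embed : (Fin (n + 1) → π.Seed) × (Fin n → ℝ) → π.Outcome) := by
  unfold embed
  refine measurable_pi_lambda _ fun t => Measurable.prodMk (by fun_prop) ?_
  refine measurable_pi_lambda _ fun i => ?_
  by_cases h : t < n
  · simp only [h, dite_true]; fun_prop
  · simp only [h, dite_false]; fun_prop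

theorem embed_fst {n : ℕ} (p : (Fin (n + 1) → π.Seed) × (Fin n → ℝ)) (t : Fin (n + 1)) :
    (π.embed p t).1 = p.1 t := by
  simp [embed, Nat.lt_succ_iff.1 t.2]

theorem embed_snd {n : ℕ} (p : (Fin (n + 1) → π.Seed) × (Fin n → ℝ)) (t : Fin n) (i : Fin K) :
    (π.embed p t).2 i = p.2 t := by
  simp [embed]

theorem measurable_likelihood_prod {X : Type*} [MeasurableSpace X] {n : ℕ} (a : Fin n → Fin K) :
    Measurable fun q : Param d × (X × (Fin n → ℝ)) =>
      ENNReal.ofReal (𝓑.likelihood a q.2.2 q.1) :=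
  ((𝓑.measurable_likelihood_uncurry a).comp
    (measurable_fst.prodMk (measurable_snd.comp measurable_snd))).ennreal_ofReal

variable [NeZero K]

/-- The first `n` observations. -/
def obs (ω : π.Outcome) (n : ℕ) : Fin n → ℝ := fun t => (ω t).2 (π.arms ω n t)

theorem arms_succ_castSucc (ω : π.Outcome) (n : ℕ) (t : Fin n) :
    π.arms ω (n + 1) t.castSucc = π.arms ω n t := by
  simp only [arms, Fin.snoc_castSucc]

theorem arms_succ_last (ω : π.Outcome) (n : ℕ) :
    π.arms ω (n + 1) (Fin.last n) = (π.action ω n).arm := by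
  simp only [arms, Fin.snoc_last, action]

theorem arms_apply (ω : π.Outcome) (n : ℕ) (t : Fin n) :
    π.arms ω n t = (π.action ω t).arm := by
  induction n with
  | zero => exact t.elim0
  | succ n ih =>
    refine Fin.lastCases ?_ (fun t => ?_) t
    · exact π.arms_succ_last ω n
    · rw [arms_succ_castSucc, ih, Fin.val_castSucc]

theorem action_eq (ω : π.Outcome) (n : ℕ) :
    π.action ω n = π.act n (fun t => (ω t).1) (π.arms ω n) (π.obs ω n) := rfl

/-- Two sample points have the same seeds up to time `n` and the same first `n` observations. -/
def Agree (n : ℕ) (ω ω' : π.Outcome) : Prop :=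
  (∀ t ≤ n, (ω t).1 = (ω' t).1) ∧ ∀ t : Fin n, (ω t).2 (π.arms ω n t) = (ω' t).2 (π.arms ω n t)

variable {π}

/-- Agreement is only required along the arms sampled under `ω`. Induction shows that this suffices:
equal histories produce the same next arm. -/
theorem Agree.arms_eq {n : ℕ} {ω ω' : π.Outcome} (h : π.Agree n ω ω') :
    π.arms ω' n = π.arms ω n := by
  induction n with
  | zero => exact Subsingleton.elim _ _
  | succ n ih =>
    have hn : π.Agree n ω ω' := by
      refine ⟨fun t ht => h.1 t (ht.trans n.le_succ), fun t => ?_⟩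
      have := h.2 t.castSucc
      rwa [arms_succ_castSucc] at this
    have harm := ih hn
    funext t
    refine Fin.lastCases ?_ (fun t => ?_) t
    · rw [arms_succ_last, arms_succ_last, action_eq, action_eq, harm]
      congr 2
      · funext t
        exact (h.1 t (Nat.le_succ_of_le (Nat.lt_succ_iff.1 t.2))).symm
      · funext t
        rw [obs, obs, harm]
        exact (hn.2 t).symm
    · rw [arms_succ_castSucc, arms_succ_castSucc, harm]

theorem Agree.mono {n k : ℕ} {ω ω' : π.Outcome} (h : π.Agree n ω ω') (hk : k ≤ n) :
    π.Agree k ω ω' := by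
  refine ⟨fun t ht => h.1 t (ht.trans hk), fun t => ?_⟩
  have := h.2 (Fin.castLE hk t)
  rwa [arms_apply] at this ⊢

theorem Agree.obs_eq {n : ℕ} {ω ω' : π.Outcome} (h : π.Agree n ω ω') :
    π.obs ω' n = π.obs ω n := by
  funext t
  rw [obs, obs, h.arms_eq]
  exact (h.2 t).symm

theorem Agree.action_eq {n : ℕ} {ω ω' : π.Outcome} (h : π.Agree n ω ω') :
    π.action ω' n = π.action ω n := by
  rw [Policy.action_eq, Policy.action_eq, h.arms_eq, h.obs_eq]
  congr 1
  funext t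
  exact (h.1 t (Nat.lt_succ_iff.1 t.2)).symm

variable (π)

/-- The event depends only on the seeds up to time `n` and on the first `n` observations. -/
def IsAdapted (n : ℕ) (D : Set π.Outcome) : Prop :=
  ∀ ω ω', π.Agree n ω ω' → (ω ∈ D ↔ ω' ∈ D)

/-- This and the next lemma let a sample point be replaced by the one rebuilt from its first `n`
observations. The arm sequence is known for the original point here, and for the rebuilt point
there. -/
theorem agree_embed_observe {n : ℕ} {a : Fin n → Fin K} {ω : π.Outcome} (h : π.arms ω n = a) :
    π.Agree n ω (π.embed (π.observe a ω)) := by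
  refine ⟨fun t ht => (π.embed_fst (π.observe a ω) ⟨t, Nat.lt_succ_of_le ht⟩).symm, fun t => ?_⟩
  rw [embed_snd, h, observe]

theorem embed_observe_agree {n : ℕ} {a : Fin n → Fin K} {ω : π.Outcome}
    (h : π.arms (π.embed (π.observe a ω)) n = a) :
    π.Agree n (π.embed (π.observe a ω)) ω := by
  refine ⟨fun t ht => π.embed_fst _ ⟨t, Nat.lt_succ_of_le ht⟩, fun t => ?_⟩
  rw [embed_snd, h, observe]

theorem obs_embed {n : ℕ} (p : (Fin (n + 1) → π.Seed) × (Fin n → ℝ)) :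
    π.obs (π.embed p) n = p.2 := by
  funext t
  rw [obs, embed_snd]

variable {π}

/-- Measurability of the arms is an assumption here because arms and actions are treated in one
induction: the arm at time `n` is read off the action after `n` samples. -/
theorem IsMeasurable.measurableSet_action_of_arms (hπ : π.IsMeasurable) (n : ℕ)
    (harms : ∀ a, MeasurableSet {ω | π.arms ω n = a}) (C : Set (Action K M)) :
    MeasurableSet {ω | π.action ω n ∈ C} := by
  have : {ω | π.action ω n ∈ C} = ⋃ c ∈ C, ⋃ a, {ω | π.arms ω n = a} ∩
      π.observe a ⁻¹' {p | π.act n p.1 a p.2 = c} := by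
    ext ω
    simp only [Set.mem_ofPred_eq, Set.mem_iUnion, Set.mem_inter_iff, Set.mem_preimage, exists_prop]
    constructor
    · intro h
      exact ⟨_, h, _, rfl, rfl⟩
    · rintro ⟨c, hc, a, rfl, h⟩
      rw [← h] at hc
      exact hc
  rw [this]
  exact .biUnion (Set.to_countable _) fun c _ => .iUnion fun a =>
    (harms a).inter (π.measurable_observe a (hπ n a c))

theorem IsMeasurable.measurableSet_arms (hπ : π.IsMeasurable) (n : ℕ) (a : Fin n → Fin K) :
    MeasurableSet {ω | π.arms ω n = a} := by
  induction n with
  | zero => convert MeasurableSet.univ using 1; ext; simp [Subsingleton.elim _ a]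
  | succ n ih =>
    have : {ω | π.arms ω (n + 1) = a} = {ω | π.arms ω n = fun t => a t.castSucc} ∩
        {ω | π.action ω n ∈ {c | c.arm = a (Fin.last n)}} := by
      ext ω
      simp only [Set.mem_ofPred_eq, Set.mem_inter_iff]
      constructor
      · rintro rfl
        exact ⟨funext fun t => (π.arms_succ_castSucc ω n t).symm, (π.arms_succ_last ω n).symm⟩
      · rintro ⟨h1, h2⟩
        funext t
        refine Fin.lastCases ?_ (fun t => ?_) t
        · rw [arms_succ_last, h2]
        · rw [arms_succ_castSucc, h1]
    rw [this]
    exact (ih _).inter (hπ.measurableSet_action_of_arms n ih _)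

theorem IsMeasurable.measurableSet_action (hπ : π.IsMeasurable) (n : ℕ) (C : Set (Action K M)) :
    MeasurableSet {ω | π.action ω n ∈ C} :=
  hπ.measurableSet_action_of_arms n (hπ.measurableSet_arms n) C

theorem IsMeasurable.measurableSet_history (hπ : π.IsMeasurable) (n : ℕ)
    {P : (Fin n → Fin K) → (Fin n → ℝ) → Prop} (hP : ∀ a, MeasurableSet {x | P a x}) :
    MeasurableSet {ω | P (π.arms ω n) (π.obs ω n)} := by
  have : {ω | P (π.arms ω n) (π.obs ω n)} = ⋃ a, {ω | π.arms ω n = a} ∩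
      (fun ω => (π.observe a ω).2) ⁻¹' {x | P a x} := by
    ext ω
    simp only [Set.mem_ofPred_eq, Set.mem_iUnion, Set.mem_inter_iff, Set.mem_preimage]
    constructor
    · intro h
      exact ⟨_, rfl, h⟩
    · rintro ⟨a, rfl, h⟩
      exact h
  rw [this]
  exact .iUnion fun a => (hπ.measurableSet_arms n a).inter
    (measurable_snd.comp (π.measurable_observe a) (hP a))

theorem isAdapted_history (n : ℕ) (P : (Fin n → Fin K) → (Fin n → ℝ) → Prop) :
    π.IsAdapted n {ω | P (π.arms ω n) (π.obs ω n)} := by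
  intro ω ω' h
  simp only [Set.mem_ofPred_eq, h.arms_eq, h.obs_eq]

/-- The probability of an event that depends on the first `n` observations, as an integral of the
likelihood. -/
theorem prob_eq_sum_lintegral (hπ : π.IsMeasurable) {n : ℕ} {D : Set π.Outcome}
    (hD : MeasurableSet D) (hadapt : π.IsAdapted n D) {η : Param d} (hη : η ∈ 𝓑.naturalSpace) :
    π.prob 𝓑 η D = ∑ a : Fin n → Fin K, ∫⁻ p in π.embed ⁻¹' (D ∩ {ω | π.arms ω n = a}),
      ENNReal.ofReal (𝓑.likelihood a p.2 η) ∂π.refMeasure 𝓑 a := by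
  -- On each piece the arm sequence is deterministic, so the law of the observations is an explicit
  -- product.
  have hpart : D = ⋃ a ∈ (Finset.univ : Finset (Fin n → Fin K)), D ∩ {ω | π.arms ω n = a} := by
    ext ω; simp
  have hm : ∀ a, MeasurableSet (D ∩ {ω | π.arms ω n = a}) :=
    fun a => hD.inter (hπ.measurableSet_arms n a)
  conv_lhs => rw [hpart]
  rw [measure_biUnion_finset _ fun a _ => hm a]
  · refine Finset.sum_congr rfl fun a _ => ?_
    rw [← withDensity_apply _ (π.measurable_embed (hm a)),
      ← π.map_observe_eq_withDensity 𝓑 a hη,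
      Measure.map_apply (π.measurable_observe a) (π.measurable_embed (hm a))]
    congr 1
    ext ω
    simp only [Set.mem_inter_iff, Set.mem_ofPred_eq, Set.mem_preimage]
    constructor
    · rintro ⟨h1, h2⟩
      have := π.agree_embed_observe h2
      exact ⟨(hadapt _ _ this).1 h1, by rw [this.arms_eq, h2]⟩
    · rintro ⟨h1, h2⟩
      have := π.embed_observe_agree h2
      exact ⟨(hadapt _ _ this).1 h1, by rw [this.arms_eq, h2]⟩
  · intro a _ b _ hab
    refine Set.disjoint_left.2 fun ω h1 h2 => hab ?_
    exact h1.2.symm.trans h2.2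

/-- The sum of likelihood integrals is measurable in every parameter, but it represents the
probability only on the natural parameter space; hence almost everywhere measurability. -/
theorem aemeasurable_prob (hπ : π.IsMeasurable) {n : ℕ} {D : Set π.Outcome}
    (hD : MeasurableSet D) (hadapt : π.IsAdapted n D) {w : Measure (Param d)}
    (hw : ∀ᵐ η ∂w, η ∈ 𝓑.naturalSpace) : AEMeasurable (fun η => π.prob 𝓑 η D) w := by
  refine ⟨_, ?_, hw.mono fun η hη => prob_eq_sum_lintegral 𝓑 hπ hD hadapt hη⟩
  refine Finset.measurable_fun_sum _ fun a _ => ?_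
  exact (measurable_likelihood_prod 𝓑 a).lintegral_prod_right'

/-- Change of measure: a lower bound for a mixture of likelihoods gives one for the mixture of
the probabilities. -/
theorem mul_prob_le_lintegral_prob (hπ : π.IsMeasurable) {n : ℕ} {D : Set π.Outcome}
    (hD : MeasurableSet D) (hadapt : π.IsAdapted n D) {η : Param d} (hη : η ∈ 𝓑.naturalSpace)
    {w : Measure (Param d)} [SFinite w] (hw : ∀ᵐ η' ∂w, η' ∈ 𝓑.naturalSpace) (c : ℝ≥0∞)
    (h : ∀ ω ∈ D, c * ENNReal.ofReal (𝓑.likelihood (π.arms ω n) (π.obs ω n) η) ≤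
      ∫⁻ η', ENNReal.ofReal (𝓑.likelihood (π.arms ω n) (π.obs ω n) η') ∂w) :
    c * π.prob 𝓑 η D ≤ ∫⁻ η', π.prob 𝓑 η' D ∂w := by
  have hmeas : ∀ a : Fin n → Fin K,
      Measurable fun q : Param d × ((Fin (n + 1) → π.Seed) × (Fin n → ℝ)) =>
        ENNReal.ofReal (𝓑.likelihood a q.2.2 q.1) := fun a =>
    measurable_likelihood_prod 𝓑 a
  rw [lintegral_congr_ae (hw.mono fun η' hη' =>
    prob_eq_sum_lintegral 𝓑 hπ hD hadapt hη'), lintegral_finsetSum _ fun a _ =>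
      (hmeas a).lintegral_prod_right', prob_eq_sum_lintegral 𝓑 hπ hD hadapt hη, Finset.mul_sum]
  refine Finset.sum_le_sum fun a _ => ?_
  have hm : MeasurableSet (π.embed (n := n) ⁻¹' (D ∩ {ω | π.arms ω n = a})) :=
    π.measurable_embed (hD.inter (hπ.measurableSet_arms n a))
  have hmη : Measurable fun p : (Fin (n + 1) → π.Seed) × (Fin n → ℝ) =>
      ENNReal.ofReal (𝓑.likelihood a p.2 η) := (hmeas a).comp (measurable_prodMk_left (x := η))
  -- After Tonelli the inequality is the pointwise hypothesis, evaluated at the rebuilt sample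
  -- point.
  rw [lintegral_lintegral_swap (hmeas a).aemeasurable, ← lintegral_const_mul _ hmη]
  refine setLIntegral_mono' hm fun p hp => ?_
  have := h _ hp.1
  rwa [hp.2, obs_embed] at this

end Policy

/-! ### Bregman divergence of the log-partition function -/

namespace ExpFamily

variable {d : ℕ} (𝓔 : ExpFamily d)

/-- The Bregman divergence of the log-partition function. -/
noncomputable def bregman (η η' : EuclideanSpace ℝ (Fin d)) : ℝ :=
  𝓔.A η' - 𝓔.A η - ⟪η' - η, gradient 𝓔.A η⟫

@[simp]
theorem bregman_self (η : EuclideanSpace ℝ (Fin d)) : 𝓔.bregman η η = 0 := by simp [bregman]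

variable {𝓔} {η η' : EuclideanSpace ℝ (Fin d)}

theorem contDiffAt_A (hη : η ∈ 𝓔.Ψ) : ContDiffAt ℝ 2 𝓔.A η :=
  𝓔.contDiffOn_A.contDiffAt (𝓔.isOpen_Ψ.mem_nhds hη)

theorem continuousOn_A : ContinuousOn 𝓔.A 𝓔.Ψ := 𝓔.contDiffOn_A.continuousOn

theorem differentiableAt_A (hη : η ∈ 𝓔.Ψ) : DifferentiableAt ℝ 𝓔.A η :=
  (contDiffAt_A hη).differentiableAt (by norm_num)

theorem inner_gradient_A (η u : EuclideanSpace ℝ (Fin d)) :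
    ⟪u, gradient 𝓔.A η⟫ = fderiv ℝ 𝓔.A η u := by
  rw [real_inner_comm, gradient, InnerProductSpace.toDual_symm_apply]

theorem continuousOn_bregman (η : EuclideanSpace ℝ (Fin d)) :
    ContinuousOn (𝓔.bregman η) 𝓔.Ψ := by
  unfold bregman
  have := 𝓔.continuousOn_A
  fun_prop

theorem strictConvexOn_bregman (η : EuclideanSpace ℝ (Fin d)) :
    StrictConvexOn ℝ 𝓔.Ψ (𝓔.bregman η) := by
  refine ⟨𝓔.convex_Ψ, fun x hx y hy hxy a b ha hb hab => ?_⟩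
  have h : 𝓔.A (a • x + b • y) < a • 𝓔.A x + b • 𝓔.A y := 𝓔.strictConvexOn_A.2 hx hy hxy ha hb hab
  simp only [bregman, smul_eq_mul, inner_sub_left, inner_add_left, real_inner_smul_left] at h ⊢
  obtain rfl : b = 1 - a := by linarith
  linarith

theorem bregman_segment_le (hη : η ∈ 𝓔.Ψ) (hη' : η' ∈ 𝓔.Ψ) {t : ℝ} (ht : 0 ≤ t) (ht' : t ≤ 1) :
    𝓔.bregman η (η + t • (η' - η)) ≤ t * 𝓔.bregman η η' := by
  have h := (𝓔.strictConvexOn_bregman η).convexOn.2 hη hη' (sub_nonneg.2 ht') ht (by ring)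
  have he : (1 - t) • η + t • η' = η + t • (η' - η) := by module
  rwa [he, bregman_self, smul_zero, zero_add, smul_eq_mul] at h

/-- Along the segment from `η` to `η'` the divergence has derivative zero at the start, while
convexity bounds its slopes by the value at `η'`. -/
theorem bregman_nonneg (hη : η ∈ 𝓔.Ψ) (hη' : η' ∈ 𝓔.Ψ) : 0 ≤ 𝓔.bregman η η' := by
  have hd : HasDerivAt (fun t : ℝ => 𝓔.bregman η (η + t • (η' - η))) 0 0 := by
    have h1 : HasDerivAt (fun t : ℝ => η + t • (η' - η)) (η' - η) 0 := by
      simpa using ((hasDerivAt_id (0 : ℝ)).smul_const (η' - η)).const_add η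
    have h2 : HasFDerivAt 𝓔.A (fderiv ℝ 𝓔.A η) (η + (0 : ℝ) • (η' - η)) := by
      simpa using (differentiableAt_A hη).hasFDerivAt
    have h3 := (h2.comp_hasDerivAt (0 : ℝ) h1).sub_const (𝓔.A η)
    have h4 : HasDerivAt (fun t : ℝ => t * fderiv ℝ 𝓔.A η (η' - η))
        (fderiv ℝ 𝓔.A η (η' - η)) 0 := by
      simpa using (hasDerivAt_id (0 : ℝ)).mul_const (fderiv ℝ 𝓔.A η (η' - η))
    have h5 := h3.sub h4
    rw [sub_self] at h5
    refine h5.congr_of_eventuallyEq (Eventually.of_forall fun t => ?_)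
    simp [bregman]
  have ht := hd.tendsto_slope_zero_right
  simp only [zero_add, zero_smul, add_zero, bregman_self, sub_zero, smul_eq_mul] at ht
  refine le_of_tendsto ht ?_
  filter_upwards [Ioc_mem_nhdsGT (zero_lt_one' ℝ)] with t h
  rw [inv_mul_le_iff₀ h.1]
  exact bregman_segment_le hη hη' h.1.le h.2

/-- The value at the midpoint is nonnegative and, by strict convexity, less than half the value at
`η'`. -/
theorem bregman_pos (hη : η ∈ 𝓔.Ψ) (hη' : η' ∈ 𝓔.Ψ) (hne : η' ≠ η) :
    0 < 𝓔.bregman η η' := by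
  have h := (𝓔.strictConvexOn_bregman η).2 hη hη' hne.symm (one_half_pos (α := ℝ))
    one_half_pos (by norm_num)
  have h0 := bregman_nonneg hη (𝓔.convex_Ψ hη hη' (one_half_pos (α := ℝ)).le
    one_half_pos.le (by norm_num))
  simp only [bregman_self, smul_eq_mul] at h
  linarith

/-- A `C²` function has a locally Lipschitz derivative, so its first-order remainder is quadratic.
-/
theorem exists_bregman_le (hη : η ∈ 𝓔.Ψ) : ∃ r > 0, ∃ C ≥ 0, ∀ η',
    ‖η' - η‖ ≤ r → η' ∈ 𝓔.Ψ ∧ 𝓔.bregman η η' ≤ C * ‖η' - η‖ ^ 2 := by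
  have h1 : ContDiffAt ℝ 1 (fderiv ℝ 𝓔.A) η :=
    (contDiffAt_A hη).fderiv_right (by norm_num)
  obtain ⟨C, s, hs, hL⟩ := h1.exists_lipschitzOnWith
  obtain ⟨r, hr, hrs⟩ := Metric.nhds_basis_closedBall.mem_iff.1
    (Filter.inter_mem hs (𝓔.isOpen_Ψ.mem_nhds hη))
  refine ⟨r, hr, C, C.2, fun η' h => ⟨(hrs (by simpa [dist_eq_norm] using h)).2, ?_⟩⟩
  -- A ball of radius exactly `‖η' - η‖` bounds the variation of the derivative by `C * ‖η' - η‖`;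
  -- the mean value inequality supplies the second factor.
  have hsub : Metric.closedBall η ‖η' - η‖ ⊆ s ∩ 𝓔.Ψ :=
    (Metric.closedBall_subset_closedBall h).trans hrs
  have := (convex_closedBall η ‖η' - η‖).norm_image_sub_le_of_norm_hasFDerivWithin_le'
    (f := 𝓔.A) (f' := fderiv ℝ 𝓔.A) (φ := fderiv ℝ 𝓔.A η) (C := C * ‖η' - η‖)
    (fun x hx => (differentiableAt_A (hsub hx).2).hasFDerivAt.hasFDerivWithinAt)
    (fun x hx => by
      refine (hL.norm_sub_le (hsub hx).1 (mem_of_mem_nhds hs)).trans ?_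
      gcongr
      simpa [dist_eq_norm] using hx)
    (Metric.mem_closedBall_self (norm_nonneg _)) (y := η') (by simp [dist_eq_norm])
  rw [bregman, inner_gradient_A]
  calc _ ≤ _ := le_abs_self _
    _ ≤ _ := this
    _ = _ := by ring

/-- The divergence has a positive minimum on a small sphere, by compactness, and convexity along
rays makes it grow at least linearly beyond that sphere. -/
theorem exists_mul_norm_le_bregman (hη : η ∈ 𝓔.Ψ) {r : ℝ} (hr : 0 < r) : ∃ c > 0, ∀ η' ∈ 𝓔.Ψ,
    r ≤ ‖η' - η‖ → c * ‖η' - η‖ ≤ 𝓔.bregman η η' := by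
  obtain ⟨ρ', hρ', hball⟩ := Metric.nhds_basis_closedBall.mem_iff.1 (𝓔.isOpen_Ψ.mem_nhds hη)
  let ρ := min ρ' r
  have hρ : 0 < ρ := lt_min hρ' hr
  have hsphere : Metric.sphere η ρ ⊆ 𝓔.Ψ := Metric.sphere_subset_closedBall.trans
    ((Metric.closedBall_subset_closedBall (min_le_left _ _)).trans hball)
  obtain ⟨m, hm, hmin⟩ : ∃ m > 0, ∀ p ∈ Metric.sphere η ρ, m ≤ 𝓔.bregman η p := by
    -- The sphere is empty in dimension zero; any constant then serves as lower bound.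
    rcases (Metric.sphere η ρ).eq_empty_or_nonempty with he | hne
    · exact ⟨1, one_pos, by simp [he]⟩
    · obtain ⟨p, hp, hpmin⟩ := (isCompact_sphere η ρ).exists_isMinOn hne
        ((continuousOn_bregman η).mono hsphere)
      refine ⟨𝓔.bregman η p, bregman_pos hη (hsphere hp) ?_, fun q hq => hpmin hq⟩
      rintro rfl
      simp [hρ.ne] at hp
  refine ⟨m / ρ, by positivity, fun η' hη' h => ?_⟩
  have hpos : 0 < ‖η' - η‖ := hr.trans_le h
  have h1 : ρ / ‖η' - η‖ ≤ 1 := (div_le_one hpos).2 ((min_le_right _ _).trans h)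
  have h2 := hmin (η + (ρ / ‖η' - η‖) • (η' - η)) (by
    simp [norm_smul, abs_of_pos hρ, hpos.ne'])
  have h3 := h2.trans (bregman_segment_le hη hη' (by positivity) h1)
  rw [div_mul_eq_mul_div, le_div_iff₀ hpos] at h3
  rw [div_mul_eq_mul_div, div_le_iff₀ hρ]
  linarith

theorem density_eq (η η' : EuclideanSpace ℝ (Fin d)) (x : ℝ) :
    𝓔.density η' x =
      𝓔.density η x * Real.exp (⟪η' - η, 𝓔.T x⟫ - (𝓔.A η' - 𝓔.A η)) := by
  rw [density, density, mul_assoc, ← Real.exp_add, inner_sub_left]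
  congr 2
  ring

end ExpFamily

/-! ### Likelihood ratios in terms of noise and divergence -/

namespace Problem

variable {K M : ℕ} {d : Fin K → ℕ} (𝓑 : Problem K M d)

theorem likelihood_eq {n : ℕ} (a : Fin n → Fin K) (x : Fin n → ℝ) (η η' : Param d) :
    𝓑.likelihood a x η' = 𝓑.likelihood a x η * Real.exp (∑ i, (⟪η' i - η i, 𝓑.statSum a x i⟫ -
      sampleCount a i * ((𝓑.arm i).A (η' i) - (𝓑.arm i).A (η i)))) := by
  unfold likelihood
  rw [Finset.prod_congr rfl fun t _ => ExpFamily.density_eq (η (a t)) (η' (a t)) (x t),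
    Finset.prod_mul_distrib, ← Real.exp_sum]
  congr 2
  have h : ∀ t, ⟪η' (a t) - η (a t), (𝓑.arm (a t)).T (x t)⟫ -
      ((𝓑.arm (a t)).A (η' (a t)) - (𝓑.arm (a t)).A (η (a t))) =
      ∑ i, if a t = i then ⟪η' i - η i, (𝓑.arm i).T (x t)⟫ -
        ((𝓑.arm i).A (η' i) - (𝓑.arm i).A (η i)) else 0 := by
    intro t
    simp
  rw [Finset.sum_congr rfl fun t _ => h t, Finset.sum_comm]
  refine Finset.sum_congr rfl fun i _ => ?_
  rw [statSum, inner_sum, sampleCount, ← Finset.sum_filter, Finset.sum_sub_distrib,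
    Finset.sum_const, nsmul_eq_mul, Finset.sum_filter]
  congr 1
  refine Finset.sum_congr rfl fun t _ => ?_
  split_ifs <;> simp

/-- The deviation of the sufficient statistic from its expectation under `η`. -/
noncomputable def noise (η : Param d) {n : ℕ} (a : Fin n → Fin K) (x : Fin n → ℝ) (i : Fin K) :
    EuclideanSpace ℝ (Fin (d i)) :=
  𝓑.statSum a x i - (sampleCount a i : ℝ) • gradient (𝓑.arm i).A (η i)

/-- Centring the statistic with `∇A` moves the linear part of `A` into the noise term and leaves the
divergence. The bounds on the averaged likelihood, on the maximum likelihood and on the noise itself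
all start from this identity. -/
theorem likelihood_eq_noise {n : ℕ} (a : Fin n → Fin K) (x : Fin n → ℝ) (η η' : Param d) :
    𝓑.likelihood a x η' = 𝓑.likelihood a x η * Real.exp (∑ i, (⟪η' i - η i, 𝓑.noise η a x i⟫ -
      sampleCount a i * (𝓑.arm i).bregman (η i) (η' i))) := by
  rw [𝓑.likelihood_eq a x η η']
  congr 2
  refine Finset.sum_congr rfl fun i _ => ?_
  rw [noise, ExpFamily.bregman, inner_sub_right, real_inner_smul_right]
  ring

end Problem

/-! ### Measurability of the policy -/

theorem mem_argmaxSet {ι β : Type*} [Fintype ι] [Nonempty ι] [LinearOrder β] {f : ι → β} {i : ι} :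
    i ∈ (argmaxSet f).1 ↔ ∀ j, f j ≤ f i := by
  simp [argmaxSet]

theorem mem_argminSet {ι β : Type*} [Fintype ι] [Nonempty ι] [LinearOrder β] {f : ι → β} {i : ι} :
    i ∈ (argminSet f).1 ↔ ∀ j, f i ≤ f j := by
  simp [argminSet, mem_argmaxSet]

theorem measurableSet_argmaxSet_eq {X ι β : Type*} [MeasurableSpace X] [Fintype ι] [Nonempty ι]
    [LinearOrder β] [TopologicalSpace β] [OrderClosedTopology β] [SecondCountableTopology β]
    [MeasurableSpace β] [OpensMeasurableSpace β]
    {f : X → ι → β} (hf : ∀ i, Measurable fun x => f x i) (S : {S : Finset ι // S.Nonempty}) :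
    MeasurableSet {x | argmaxSet (f x) = S} := by
  have : {x | argmaxSet (f x) = S} =
      ⋂ i, {x | i ∈ S.1 ↔ ∀ j, f x j ≤ f x i} := by
    ext x
    simp only [Set.mem_ofPred_eq, Set.mem_iInter, Subtype.ext_iff, Finset.ext_iff, mem_argmaxSet]
    exact forall_congr' fun i => Iff.comm
  rw [this]
  refine .iInter fun i => ?_
  have h : MeasurableSet {x | ∀ j, f x j ≤ f x i} := by
    rw [Set.ofPred_forall]
    exact .iInter fun j => measurableSet_le (hf j) (hf i)
  by_cases hi : i ∈ S.1
  · simpa only [hi, true_iff] using h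
  · simp only [hi, false_iff]
    exact h.compl

theorem exists_ball_inter_affineSpan_subset {E : Type*} [NormedAddCommGroup E] [NormedSpace ℝ E]
    {S : Set E} (hS : intrinsicInterior ℝ S = S) {x : E} (hx : x ∈ S) :
    ∃ ε > 0, ∀ y ∈ affineSpan ℝ S, ‖y - x‖ < ε → y ∈ S := by
  rw [← hS, mem_intrinsicInterior] at hx
  obtain ⟨y, hy, rfl⟩ := hx
  obtain ⟨ε, hε, hball⟩ := Metric.mem_nhds_iff.1 (mem_interior_iff_mem_nhds.1 hy)
  exact ⟨ε, hε, fun z hz hd => @hball ⟨z, hz⟩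
    (by rw [Metric.mem_ball, Subtype.dist_eq, dist_eq_norm]; exact hd)⟩

/-- A relatively open set is the intersection of its affine hull, which is closed, with an open set.
-/
theorem measurableSet_of_intrinsicInterior_eq {E : Type*} [NormedAddCommGroup E]
    [NormedSpace ℝ E] [FiniteDimensional ℝ E] [MeasurableSpace E] [BorelSpace E]
    {S : Set E} (hS : intrinsicInterior ℝ S = S) : MeasurableSet S := by
  choose ε hε h using fun x : S => exists_ball_inter_affineSpan_subset hS x.2
  have : S = (affineSpan ℝ S : Set E) ∩ ⋃ x : S, Metric.ball (x : E) (ε x) := by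
    ext y
    simp only [Set.mem_inter_iff, Set.mem_iUnion, Metric.mem_ball, dist_eq_norm]
    exact ⟨fun hy => ⟨subset_affineSpan ℝ S hy, ⟨y, hy⟩, by simpa using hε ⟨y, hy⟩⟩,
      fun ⟨hy, x, hx⟩ => h x y hy hx⟩
  rw [this]
  exact (AffineSubspace.closed_of_finiteDimensional _).measurableSet.inter
    (isOpen_iUnion fun _ => Metric.isOpen_ball).measurableSet

instance {E : Type*} [NormedAddCommGroup E] [NormedSpace ℝ E] [FiniteDimensional ℝ E]
    [MeasurableSpace E] [BorelSpace E] (S : Set E) : SFinite (affineLebesgue S) := by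
  unfold affineLebesgue
  split_ifs <;> infer_instance

/-- The countable set is chosen before the function, so a supremum of likelihoods becomes one
countable supremum for all observations at once. -/
theorem exists_countable_biSup_eq {E : Type*} [TopologicalSpace E] [SecondCountableTopology E]
    (S : Set E) : ∃ D ⊆ S, D.Countable ∧
      ∀ f : E → ℝ≥0∞, ContinuousOn f S → ⨆ y ∈ S, f y = ⨆ y ∈ D, f y := by
  obtain ⟨D, hDc, hDd⟩ := TopologicalSpace.exists_countable_dense S
  refine ⟨(↑) '' D, by simp, hDc.image _, fun f hf => le_antisymm ?_ ?_⟩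
  · refine iSup₂_le fun y hy => le_of_forall_lt fun c hc => ?_
    have hopen : IsOpen {z : S | c < f z} :=
      isOpen_lt continuous_const (continuousOn_iff_continuous_domRestrict.1 hf)
    obtain ⟨z, hz, hzD⟩ := hDd.inter_open_nonempty _ hopen ⟨⟨y, hy⟩, hc⟩
    exact lt_of_lt_of_le hz (le_iSup₂_of_le (z : E) ⟨z, hzD, rfl⟩ le_rfl)
  · exact biSup_mono fun y ⟨z, _, hz⟩ => hz ▸ z.2

namespace Problem

variable {K M : ℕ} {d : Fin K → ℕ} (𝓑 : Problem K M d)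

theorem measurableSet_Θ (m : Fin M) : MeasurableSet (𝓑.Θ m) :=
  measurableSet_of_intrinsicInterior_eq (𝓑.relOpen_Θ m)

theorem continuousOn_A_apply (i : Fin K) :
    ContinuousOn (fun η : Param d => (𝓑.arm i).A (η i)) 𝓑.naturalSpace :=
  (𝓑.arm i).continuousOn_A.comp (continuous_apply i).continuousOn fun _ h => h i

theorem continuousOn_likelihood {n : ℕ} (a : Fin n → Fin K) (x : Fin n → ℝ) :
    ContinuousOn (𝓑.likelihood a x) 𝓑.naturalSpace := by
  unfold likelihood ExpFamily.density
  have := 𝓑.continuousOn_A_apply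
  refine continuousOn_finsetProd _ fun t _ => ?_
  have h := this (a t)
  fun_prop

theorem measurable_maxLikelihood {n : ℕ} (a : Fin n → Fin K) (m : Fin M) :
    Measurable fun x => 𝓑.maxLikelihood a x m := by
  obtain ⟨D, -, hDc, hD⟩ := exists_countable_biSup_eq (𝓑.Θ m)
  have : (fun x => 𝓑.maxLikelihood a x m) =
      fun x => ⨆ η ∈ D, ENNReal.ofReal (𝓑.likelihood a x η) := by
    funext x
    exact hD _ (ENNReal.continuous_ofReal.comp_continuousOn
      ((𝓑.continuousOn_likelihood a x).mono (𝓑.Θ_subset_naturalSpace m)))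
  rw [this]
  refine Measurable.biSup D hDc fun η _ => Measurable.ennreal_ofReal ?_
  exact (𝓑.measurable_likelihood_uncurry a).comp (measurable_prodMk_left (x := η))

theorem measurable_priorKernel (Υ : Param d) (n₀ : Fin K → ℝ) :
    Measurable (𝓑.priorKernel Υ n₀) := by
  unfold priorKernel
  have : ∀ i, Measurable fun η : Param d => (𝓑.arm i).A (η i) :=
    fun i => (𝓑.arm i).measurable_A.comp (measurable_pi_apply i)
  refine Measurable.ennreal_ofReal (Finset.measurable_fun_prod _ fun i _ => ?_)
  have h := this i
  fun_prop

theorem measurable_avgLikelihood (Υ : Param d) (n₀ : Fin K → ℝ) {n : ℕ} (a : Fin n → Fin K)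
    (l : Fin M) : Measurable fun x => 𝓑.avgLikelihood Υ n₀ a x l := by
  unfold avgLikelihood
  refine Measurable.lintegral_prod_left' (f := fun q : Param d × (Fin n → ℝ) =>
    ENNReal.ofReal (𝓑.likelihood a q.2 q.1) *
      ((𝓑.priorMass Υ n₀ l)⁻¹ * 𝓑.priorKernel Υ n₀ q.1)) ?_
  have h1 := 𝓑.measurable_likelihood_uncurry a
  have h2 := 𝓑.measurable_priorKernel Υ n₀
  fun_prop

theorem measurable_modGLR (Υ : Param d) (n₀ : Fin K → ℝ) {n : ℕ} (a : Fin n → Fin K)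
    (l : Fin M) : Measurable fun x => 𝓑.modGLR Υ n₀ a x l := by
  unfold modGLR pairGLR
  refine Measurable.iInf fun m => ENNReal.measurable_log.comp ?_
  exact (𝓑.measurable_avgLikelihood Υ n₀ a l).div (𝓑.measurable_maxLikelihood a m)

end Problem

/-- A measurable quantity with countably many values may be treated as constant. -/
theorem measurableSet_of_forall_eq {X ι : Type*} [MeasurableSpace X] [Countable ι] (f : X → ι)
    (hf : ∀ i, MeasurableSet {x | f x = i}) {P : ι → X → Prop}
    (hP : ∀ i, MeasurableSet {x | P i x}) : MeasurableSet {x | P (f x) x} := by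
  have : {x | P (f x) x} = ⋃ i, {x | f x = i} ∩ {x | P i x} := by
    ext x; simp
  rw [this]
  exact .iUnion fun i => (hf i).inter (hP i)

theorem measurableSet_trackingArm_eq {X : Type*} [MeasurableSpace X] {K : ℕ} [NeZero K] (β : ℝ)
    (na : ℕ) (N : Fin K → ℕ) {w : X → Fin K → ℝ} (hw : Measurable w) (ξ : TieBreak K)
    (i : Fin K) : MeasurableSet {x | trackingArm β na N (w x) ξ = i} := by
  unfold trackingArm
  split_ifs with h
  · exact .const _
  · refine measurableSet_of_forall_eq _ (measurableSet_argmaxSet_eq fun j => ?_)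
      (P := fun S _ => ξ S = i) fun S => .const _
    fun_prop

/-- The seeds have finitely many values and can be frozen, and then so can the leader. What is left
depends on the observations through the statistics, the estimates and the sampling distribution, all
measurable. -/
theorem piSMF_isMeasurable {K M : ℕ} [NeZero K] [NeZero M] {d : Fin K → ℕ} (𝓑 : Problem K M d)
    (Υ : Param d) (n₀ : Fin K → ℝ)
    {est : (n : ℕ) → (Fin n → Fin K) → (Fin n → ℝ) → Fin M → Param d}
    (hest : ∀ n a m, Measurable fun x => est n a x m)
    {lam : Param d → Fin K → ℝ} (hlam : Measurable lam) (L : ℝ) (γ : I) (β : ℝ) :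
    (piSMF 𝓑 Υ n₀ est lam L γ β).IsMeasurable := by
  intro n a c
  change MeasurableSet {p : (Fin (n + 1) → StageSeed K M) × (Fin n → ℝ) |
    (piSMF 𝓑 Υ n₀ est lam L γ β).act n p.1 a p.2 = c}
  refine measurableSet_of_forall_eq (fun p : (Fin (n + 1) → StageSeed K M) × (Fin n → ℝ) => p.1)
    (fun s => measurable_fst (measurableSet_singleton s))
    (P := fun s p => (piSMF 𝓑 Υ n₀ est lam L γ β).act n s a p.2 = c) fun s => ?_
  suffices h : MeasurableSet {x | (piSMF 𝓑 Υ n₀ est lam L γ β).act n s a x = c} from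
    measurable_snd h
  cases n with
  | zero =>
    change MeasurableSet {_x : Fin 0 → ℝ | Action.sample (0 : Fin K) = c}
    exact .const _
  | succ n =>
    refine measurableSet_of_forall_eq (fun x => (s (Fin.last (n + 1))).2.1
      (argmaxSet (𝓑.modGLR Υ n₀ a x))) (fun l => ?_)
      (P := fun l x => (if 𝓑.modGLR Υ n₀ a x l < ((Real.log ((M - 1) * L) : ℝ) : EReal) then
        .sample <|
          if (s (Fin.last (n + 1))).1 = true then
            trackingArm β ((activeTimes s).card + 1) (activeCount s a)
              (lam (est (n + 1) a x l)) (s (Fin.last (n + 1))).2.2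
          else a (Fin.last n)
      else .halt l) = c) fun l => ?_
    · exact measurableSet_of_forall_eq _
        (measurableSet_argmaxSet_eq fun l => 𝓑.measurable_modGLR Υ n₀ a l)
        (P := fun S _ => (s (Fin.last (n + 1))).2.1 S = l) fun S => .const _
    · refine MeasurableSet.congr (s := ({x | 𝓑.modGLR Υ n₀ a x l <
        ((Real.log ((M - 1) * L) : ℝ) : EReal)}).ite {x | Action.sample (
          if (s (Fin.last (n + 1))).1 = true then
            trackingArm β ((activeTimes s).card + 1) (activeCount s a)
              (lam (est (n + 1) a x l)) (s (Fin.last (n + 1))).2.2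
          else a (Fin.last n)) = c} {x | Action.halt l = c}) ?_ ?_
      · refine MeasurableSet.ite (measurableSet_lt (𝓑.measurable_modGLR Υ n₀ a l)
          measurable_const) ?_ (.const _)
        split_ifs
        · exact measurableSet_of_forall_eq _ (measurableSet_trackingArm_eq β _ _
            (hlam.comp (hest (n + 1) a l)) _) (P := fun i _ => Action.sample i = c)
            fun _ => .const _
        · exact .const _
      · ext x
        by_cases hx : 𝓑.modGLR Υ n₀ a x l < ((Real.log ((M - 1) * L) : ℝ) : EReal) <;>
          simp [Set.ite, hx]

/-! ### Halting events -/

theorem Action.decision?_eq_some {K M : ℕ} {c : Action K M} {m : Fin M} :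
    c.decision? = some m ↔ c = .halt m := by
  cases c <;> simp [Action.decision?]

namespace Policy

variable {K M : ℕ} [NeZero K] {d : Fin K → ℕ} {π : Policy K M} (𝓑 : Problem K M d)

variable (π) in
/-- The event that the policy stops after `n` samples and declares `m`. -/
def haltEvent (n : ℕ) (m : Fin M) : Set π.Outcome :=
  {ω | (∀ k < n, (π.action ω k).decision? = none) ∧ π.action ω n = .halt m}

theorem decision_eq_some_iff {ω : π.Outcome} {m : Fin M} :
    π.decision ω = some m ↔ ∃ n, ω ∈ π.haltEvent n m := by
  classical
  unfold decision
  constructor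
  · intro h
    split_ifs at h with hex
    refine ⟨Nat.find hex, fun k hk => ?_, Action.decision?_eq_some.1 (by convert h)⟩
    simpa using Nat.find_min hex hk
  · rintro ⟨n, hlt, hn⟩
    have hn' := Action.decision?_eq_some.2 hn
    have hex : ∃ n, (π.action ω n).decision? ≠ none := ⟨n, by simp [hn']⟩
    have hfind : Nat.find hex = n :=
      (Nat.find_eq_iff hex).2 ⟨by simp [hn'], fun k hk => by simp [hlt k hk]⟩
    rw [dif_pos hex]
    convert hn'

theorem decision_eq_none_iff {ω : π.Outcome} :
    π.decision ω = none ↔ ∀ n, (π.action ω n).decision? = none := by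
  classical
  unfold decision
  constructor
  · intro h
    split_ifs at h with hex
    · exact absurd (by convert h) (Nat.find_spec hex)
    · simpa using hex
  · intro h
    rw [dif_neg (by simpa using h)]

theorem IsMeasurable.measurableSet_haltEvent (hπ : π.IsMeasurable) (n : ℕ) (m : Fin M) :
    MeasurableSet (π.haltEvent n m) := by
  have : π.haltEvent n m = (⋂ k, ⋂ _ : k < n, {ω | π.action ω k ∈ {c | c.decision? = none}}) ∩
      {ω | π.action ω n ∈ ({.halt m} : Set (Action K M))} := by
    ext ω; simp [haltEvent]
  rw [this]
  exact (MeasurableSet.iInter fun k => .iInter fun _ => hπ.measurableSet_action k _).inter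
    (hπ.measurableSet_action n _)

theorem isAdapted_haltEvent (n : ℕ) (m : Fin M) : π.IsAdapted n (π.haltEvent n m) := by
  intro ω ω' h
  unfold haltEvent
  simp only [Set.mem_ofPred_eq, h.action_eq]
  refine and_congr_left fun _ => forall₂_congr fun k hk => ?_
  rw [(h.mono hk.le).action_eq]

theorem disjoint_haltEvent (m : Fin M) :
    Pairwise (Function.onFun Disjoint fun n => π.haltEvent n m) := by
  have key : ∀ n n', n < n' → ∀ ω ∈ π.haltEvent n m, ω ∉ π.haltEvent n' m := by
    rintro n n' h ω ⟨-, h1⟩ ⟨h2, -⟩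
    have := h2 n h
    rw [h1] at this
    simp [Action.decision?] at this
  intro n n' hne
  rcases hne.lt_or_gt with h | h
  · exact Set.disjoint_left.2 (key n n' h)
  · exact Set.disjoint_right.2 (key n' n h)

end Policy

/-! ### The conjugate prior as a measure -/

namespace Problem

variable {K M : ℕ} {d : Fin K → ℕ} (𝓑 : Problem K M d)

/-- The conjugate prior as a measure. -/
noncomputable def prior (Υ : Param d) (n₀ : Fin K → ℝ) (l : Fin M) : Measure (Param d) :=
  ((affineLebesgue (𝓑.Θ l)).restrict (𝓑.Θ l)).withDensity
    fun η => (𝓑.priorMass Υ n₀ l)⁻¹ * 𝓑.priorKernel Υ n₀ η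

instance (Υ : Param d) (n₀ : Fin K → ℝ) (l : Fin M) : SFinite (𝓑.prior Υ n₀ l) := by
  unfold prior; infer_instance

theorem measurable_priorDensity (Υ : Param d) (n₀ : Fin K → ℝ) (l : Fin M) :
    Measurable fun η => (𝓑.priorMass Υ n₀ l)⁻¹ * 𝓑.priorKernel Υ n₀ η :=
  (𝓑.measurable_priorKernel Υ n₀).const_mul _

/-- The inequality survives a total mass `0` or `∞`, and a subprobability is all that the error
bound needs. -/
theorem prior_univ_le_one (Υ : Param d) (n₀ : Fin K → ℝ) (l : Fin M) :
    𝓑.prior Υ n₀ l Set.univ ≤ 1 := by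
  rw [prior, withDensity_apply _ .univ, Measure.restrict_univ,
    lintegral_const_mul _ (𝓑.measurable_priorKernel Υ n₀)]
  exact ENNReal.inv_mul_le_one _

theorem ae_prior_mem (Υ : Param d) (n₀ : Fin K → ℝ) (l : Fin M) :
    ∀ᵐ η ∂𝓑.prior Υ n₀ l, η ∈ 𝓑.Θ l :=
  (withDensity_absolutelyContinuous _ _).ae_le (ae_restrict_mem (𝓑.measurableSet_Θ l))

theorem avgLikelihood_eq (Υ : Param d) (n₀ : Fin K → ℝ) {n : ℕ} (a : Fin n → Fin K)
    (x : Fin n → ℝ) (l : Fin M) : 𝓑.avgLikelihood Υ n₀ a x l =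
      ∫⁻ η, ENNReal.ofReal (𝓑.likelihood a x η) ∂𝓑.prior Υ n₀ l := by
  have hm := (𝓑.measurable_likelihood_uncurry a).ennreal_ofReal
  rw [prior]
  refine Eq.trans ?_ (lintegral_withDensity_eq_lintegral_mul _ (𝓑.measurable_priorDensity Υ n₀ l)
    (hm.comp (measurable_prodMk_right (y := x)))).symm
  exact lintegral_congr fun η => mul_comm _ _

end Problem

namespace Problem

/-- The threshold condition is cleared of logarithms and quotients. This direction stays valid if
the maximum likelihood is `0` or `∞`. -/
theorem mul_maxLikelihood_le_of_log_le_modGLR {K M : ℕ} {d : Fin K → ℕ} (𝓑 : Problem K M d) {n : ℕ} {a : Fin n → Fin K} {x : Fin n → ℝ}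
    {Υ : Param d} {n₀ : Fin K → ℝ} {l m : Fin M} (hlm : l ≠ m) {c : ℝ} (hc : 0 < c)
    (h : ((Real.log c : ℝ) : EReal) ≤ 𝓑.modGLR Υ n₀ a x m) :
    ENNReal.ofReal c * 𝓑.maxLikelihood a x l ≤ 𝓑.avgLikelihood Υ n₀ a x m := by
  have h1 : ((Real.log c : ℝ) : EReal) ≤ 𝓑.pairGLR Υ n₀ a x m l :=
    h.trans (iInf_le (fun m' : {m' : Fin M // m' ≠ m} => 𝓑.pairGLR Υ n₀ a x m m') ⟨l, hlm⟩)
  rw [← ENNReal.log_ofReal_of_pos hc, pairGLR, ENNReal.log_le_log_iff] at h1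
  exact ENNReal.mul_le_of_le_div h1

end Problem

/-! ### Probability of a wrong declaration -/

section FalseDetection

variable {K M : ℕ} [NeZero K] {d : Fin K → ℕ} {π : Policy K M} (𝓑 : Problem K M d)

/-- If a policy only declares `m` when the averaged likelihood of `m` is at least `c` times the
maximum likelihood of `l`, then it wrongly declares `m` with probability at most `c⁻¹`. -/
theorem mul_prob_decision_le_one (hπ : π.IsMeasurable) (Υ : Param d) (n₀ : Fin K → ℝ)
    {l m : Fin M} (c : ℝ≥0∞)
    (h : ∀ n, ∀ ω ∈ π.haltEvent n m, c * 𝓑.maxLikelihood (π.arms ω n) (π.obs ω n) l ≤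
      𝓑.avgLikelihood Υ n₀ (π.arms ω n) (π.obs ω n) m) {η : Param d} (hη : η ∈ 𝓑.Θ l) :
    c * π.prob 𝓑 η {ω | π.decision ω = some m} ≤ 1 := by
  have hset : {ω | π.decision ω = some m} = ⋃ n, π.haltEvent n m := by
    ext ω; simp [Policy.decision_eq_some_iff]
  have hm := fun n => hπ.measurableSet_haltEvent n m
  have hprior : ∀ᵐ η' ∂𝓑.prior Υ n₀ m, η' ∈ 𝓑.naturalSpace :=
    (𝓑.ae_prior_mem Υ n₀ m).mono fun η' hη' => 𝓑.Θ_subset_naturalSpace m hη'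
  rw [hset, measure_iUnion (Policy.disjoint_haltEvent m) hm, ← ENNReal.tsum_mul_left]
  calc ∑' n, c * π.prob 𝓑 η (π.haltEvent n m)
      ≤ ∑' n, ∫⁻ η', π.prob 𝓑 η' (π.haltEvent n m) ∂𝓑.prior Υ n₀ m := by
        refine ENNReal.tsum_le_tsum fun n => ?_
        refine Policy.mul_prob_le_lintegral_prob 𝓑 hπ (hm n) (Policy.isAdapted_haltEvent n m)
          (𝓑.Θ_subset_naturalSpace l hη) hprior c fun ω hω => ?_
        rw [← 𝓑.avgLikelihood_eq]
        refine le_trans ?_ (h n ω hω)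
        gcongr
        exact le_iSup₂_of_le η hη le_rfl
    _ = ∫⁻ η', ∑' n, π.prob 𝓑 η' (π.haltEvent n m) ∂𝓑.prior Υ n₀ m :=
        (lintegral_tsum fun n => Policy.aemeasurable_prob 𝓑 hπ (hm n)
          (Policy.isAdapted_haltEvent n m) hprior).symm
    -- Under each single `η'` the halting events at different times are disjoint, so their
    -- probabilities sum to at most one.
    _ ≤ ∫⁻ _, 1 ∂𝓑.prior Υ n₀ m := by
        refine lintegral_mono_ae (hprior.mono fun η' hη' => ?_)
        have := π.isProbabilityMeasure_prob_of_mem 𝓑 hη'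
        rw [← measure_iUnion (Policy.disjoint_haltEvent m) hm]
        exact prob_le_one
    _ ≤ 1 := by simpa using 𝓑.prior_univ_le_one Υ n₀ m

variable [NeZero M] {Υ : Param d} {n₀ : Fin K → ℝ}
    {est : (n : ℕ) → (Fin n → Fin K) → (Fin n → ℝ) → Fin M → Param d}
    {lam : Param d → Fin K → ℝ} {L : ℝ} {γ : I} {β : ℝ}

variable (Υ n₀) in
/-- The hypothesis with the largest statistic, ties being resolved by the seed. -/
noncomputable def leader {n : ℕ} (s : Fin (n + 1) → StageSeed K M) (a : Fin n → Fin K)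
    (x : Fin n → ℝ) : Fin M :=
  (s (Fin.last n)).2.1 (argmaxSet (𝓑.modGLR Υ n₀ a x))

theorem piSMF_act_of_lt {n : ℕ} {s : Fin (n + 1 + 1) → StageSeed K M} {a : Fin (n + 1) → Fin K}
    {x : Fin (n + 1) → ℝ} (h : 𝓑.modGLR Υ n₀ a x (leader 𝓑 Υ n₀ s a x) <
      ((Real.log ((M - 1) * L) : ℝ) : EReal)) :
    (piSMF 𝓑 Υ n₀ est lam L γ β).act (n + 1) s a x = .sample
      (if (s (Fin.last (n + 1))).1 = true then
        trackingArm β ((activeTimes s).card + 1) (activeCount s a)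
          (lam (est (n + 1) a x (leader 𝓑 Υ n₀ s a x))) (s (Fin.last (n + 1))).2.2
      else a (Fin.last n)) :=
  if_pos h

theorem piSMF_act_of_le {n : ℕ} {s : Fin (n + 1 + 1) → StageSeed K M} {a : Fin (n + 1) → Fin K}
    {x : Fin (n + 1) → ℝ} (h : ((Real.log ((M - 1) * L) : ℝ) : EReal) ≤
      𝓑.modGLR Υ n₀ a x (leader 𝓑 Υ n₀ s a x)) :
    (piSMF 𝓑 Υ n₀ est lam L γ β).act (n + 1) s a x = .halt (leader 𝓑 Υ n₀ s a x) :=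
  if_neg (not_lt.2 h)

theorem log_le_modGLR_of_act_eq_halt {n : ℕ} {s : Fin (n + 1) → StageSeed K M}
    {a : Fin n → Fin K} {x : Fin n → ℝ} {m : Fin M}
    (h : (piSMF 𝓑 Υ n₀ est lam L γ β).act n s a x = .halt m) :
    ((Real.log ((M - 1) * L) : ℝ) : EReal) ≤ 𝓑.modGLR Υ n₀ a x m := by
  cases n with
  | zero => exact absurd h (by simp [piSMF])
  | succ n =>
    rcases lt_or_ge (𝓑.modGLR Υ n₀ a x (leader 𝓑 Υ n₀ s a x))
      ((Real.log ((M - 1) * L) : ℝ) : EReal) with h1 | h1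
    · rw [piSMF_act_of_lt 𝓑 h1] at h
      cases h
    · rw [piSMF_act_of_le 𝓑 h1] at h
      rwa [← Action.halt.inj h]

theorem prob_wrong_decision_le (hM : 2 ≤ M)
    (hest : ∀ n a m, Measurable fun x => est n a x m) (hlam : Measurable lam) {α : ℝ}
    (hα : 0 < α) {l : Fin M} {η : Param d} (hη : η ∈ 𝓑.Θ l) :
    (piSMF 𝓑 Υ n₀ est lam (1 / α) γ β).prob 𝓑 η
      {ω | ∃ m, m ≠ l ∧ (piSMF 𝓑 Υ n₀ est lam (1 / α) γ β).decision ω = some m} ≤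
        ENNReal.ofReal α := by
  set π := piSMF 𝓑 Υ n₀ est lam (1 / α) γ β with hπdef
  have hM1 : (0 : ℝ) < M - 1 := by
    have : (2 : ℝ) ≤ M := by exact_mod_cast hM
    linarith
  have hc : 0 < ((M : ℝ) - 1) * (1 / α) := by positivity
  have hset : {ω | ∃ m, m ≠ l ∧ π.decision ω = some m} =
      ⋃ m ∈ Finset.univ.erase l, {ω | π.decision ω = some m} := by
    ext ω; simp
  rw [hset]
  refine (measure_biUnion_finset_le _ _).trans ?_
  calc ∑ m ∈ Finset.univ.erase l, π.prob 𝓑 η {ω | π.decision ω = some m}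
      ≤ ∑ m ∈ Finset.univ.erase l, (ENNReal.ofReal (((M : ℝ) - 1) * (1 / α)))⁻¹ := by
        refine Finset.sum_le_sum fun m hm => ?_
        rw [ENNReal.le_inv_iff_mul_le, mul_comm]
        refine mul_prob_decision_le_one 𝓑 (piSMF_isMeasurable 𝓑 Υ n₀ hest hlam _ γ β) Υ n₀ _
          (fun n ω hω => ?_) hη
        exact 𝓑.mul_maxLikelihood_le_of_log_le_modGLR (Finset.ne_of_mem_erase hm).symm hc
          (log_le_modGLR_of_act_eq_halt 𝓑 hω.2)
    _ = ENNReal.ofReal α := by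
        rw [Finset.sum_const, Finset.card_erase_of_mem (Finset.mem_univ l), Finset.card_univ,
          Fintype.card_fin, nsmul_eq_mul, ← ENNReal.ofReal_inv_of_pos hc,
          ← ENNReal.ofReal_natCast, ← ENNReal.ofReal_mul (by positivity),
          Nat.cast_sub (by omega), Nat.cast_one]
        congr 1
        field_simp

end FalseDetection

/-! ### Forced exploration: growth rates and a counting argument -/

theorem eventually_const_mul_rpow_le (C : ℝ) {a b : ℝ} (hab : a < b) :
    ∀ᶠ n : ℕ in atTop, C * (n : ℝ) ^ a ≤ (n : ℝ) ^ b := by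
  have h : Tendsto (fun n : ℕ => (n : ℝ) ^ (b - a)) atTop atTop :=
    (tendsto_rpow_atTop (sub_pos.2 hab)).comp tendsto_natCast_atTop_atTop
  filter_upwards [h.eventually_ge_atTop C, eventually_gt_atTop 0] with n hn hpos
  have hpos' : (0 : ℝ) < n := by exact_mod_cast hpos
  calc C * (n : ℝ) ^ a ≤ (n : ℝ) ^ (b - a) * (n : ℝ) ^ a := by gcongr
    _ = (n : ℝ) ^ b := by rw [← Real.rpow_add hpos', sub_add_cancel]

/-- The forced exploration threshold is of order `n ^ β`. -/
theorem eventually_exploration_threshold (k : ℕ) {β β' C ρ : ℝ} (hβ' : 0 < β') (hlt : β' < β)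
    (hβ : β < 1) (hC : 0 ≤ C) (hρ : 0 < ρ) :
    ∀ᶠ n : ℕ in atTop, ∃ r s : ℕ, (n : ℝ) ^ β' ≤ r ∧ (r : ℝ) ≤ (s : ℝ) ^ β - C ∧
      ((s + 1 + k * r : ℕ) : ℝ) ≤ ρ * n := by
  -- The witnesses are `r ≈ n ^ β'` and `s ≈ n ^ (b / β)`: then `s ^ β ≥ n ^ b` dominates `r + C`,
  -- while `b / β < 1` keeps `s` and `r` of smaller order than `n`.
  obtain ⟨b, hb1, hb2⟩ := exists_between hlt
  have hb0 : 0 < b := hβ'.trans hb1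
  have hβ0 : 0 < β := hb0.trans hb2
  have hq : b / β < 1 := (div_lt_one hβ0).2 hb2
  have hbq : b ≤ b / β := by rw [le_div_iff₀ hβ0]; nlinarith
  filter_upwards [eventually_const_mul_rpow_le (2 + C) hb1,
    eventually_const_mul_rpow_le ((3 + k) / ρ) hq, eventually_ge_atTop 1] with n h1 h2 hn
  have hn1 : (1 : ℝ) ≤ n := by exact_mod_cast hn
  have hn0 : (0 : ℝ) ≤ n := by linarith
  have hone : 1 ≤ (n : ℝ) ^ β' := Real.one_le_rpow hn1 hβ'.le
  have hr : (⌈(n : ℝ) ^ β'⌉₊ : ℝ) ≤ (n : ℝ) ^ β' + 1 := (Nat.ceil_lt_add_one (by linarith)).le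
  have hrC : (⌈(n : ℝ) ^ β'⌉₊ : ℝ) + C ≤ (n : ℝ) ^ b := by nlinarith
  refine ⟨⌈(n : ℝ) ^ β'⌉₊, ⌈(n : ℝ) ^ (b / β)⌉₊, Nat.le_ceil _, ?_, ?_⟩
  · have h3 : (n : ℝ) ^ b ≤ (⌈(n : ℝ) ^ (b / β)⌉₊ : ℝ) ^ β := by
      calc (n : ℝ) ^ b = ((n : ℝ) ^ (b / β)) ^ β := by
            rw [← Real.rpow_mul hn0, div_mul_cancel₀ _ hβ0.ne']
        _ ≤ _ := Real.rpow_le_rpow (by positivity) (Nat.le_ceil _) hβ0.le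
    linarith
  · have h3 : (⌈(n : ℝ) ^ (b / β)⌉₊ : ℝ) ≤ (n : ℝ) ^ (b / β) + 1 :=
      (Nat.ceil_lt_add_one (by positivity)).le
    have h4 : (⌈(n : ℝ) ^ β'⌉₊ : ℝ) ≤ (n : ℝ) ^ (b / β) :=
      (by linarith : _ ≤ (n : ℝ) ^ b).trans (Real.rpow_le_rpow_of_exponent_le hn1 hbq)
    have h5 : 1 ≤ (n : ℝ) ^ (b / β) := Real.one_le_rpow hn1 (by positivity)
    rw [Real.rpow_one, div_mul_eq_mul_div, div_le_iff₀ hρ] at h2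
    push_cast
    nlinarith [mul_le_mul_of_nonneg_left h4 (Nat.cast_nonneg (α := ℝ) k)]

section Greedy

variable {K : ℕ} (b : ℕ → Prop) [DecidablePred b] (arm : ℕ → Fin K)

theorem card_filter_range_succ (p : ℕ → Prop) [DecidablePred p] (n : ℕ) :
    ((Finset.range (n + 1)).filter p).card =
      ((Finset.range n).filter p).card + if p n then 1 else 0 := by
  rw [Finset.range_add_one, Finset.filter_insert]
  split_ifs
  · rw [Finset.card_insert_of_notMem (by simp)]
  · simp

/-- If, as soon as more than `s` active samples have been taken and as long as some arm has been
sampled less than `r` times, an arm with the least number of samples is chosen, then each arm is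
sampled `r` times within the first `s + 1 + K * r` active samples. -/
theorem le_card_of_greedy (r s : ℕ)
    (h : ∀ t, b t → s < ((Finset.range t).filter b).card →
      (∃ i, ((Finset.range t).filter fun u => b u ∧ arm u = i).card < r) →
      ∀ j, ((Finset.range t).filter fun u => b u ∧ arm u = arm t).card ≤
        ((Finset.range t).filter fun u => b u ∧ arm u = j).card) (n : ℕ)
    (hn : s + 1 + K * r ≤ ((Finset.range n).filter b).card) (i : Fin K) :
    r ≤ ((Finset.range n).filter fun u => b u ∧ arm u = i).card := by
  set N : Fin K → ℕ → ℕ := fun i n => ((Finset.range n).filter fun u => b u ∧ arm u = i).card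
    with hN
  -- The potential counts samples truncated at `r` per arm; it equals its maximum `K * r` only if
  -- every arm has been sampled `r` times.
  set Φ : ℕ → ℕ := fun n => ∑ i, min (N i n) r with hΦ
  have hNsucc : ∀ i n, N i (n + 1) = N i n + if b n ∧ arm n = i then 1 else 0 :=
    fun i n => card_filter_range_succ _ n
  have hmono : ∀ n, Φ n ≤ Φ (n + 1) := fun n =>
    Finset.sum_le_sum fun i _ => min_le_min_right _ (by rw [hNsucc]; omega)
  have hle : ∀ n, Φ n ≤ K * r := fun n => by
    calc Φ n ≤ ∑ _i : Fin K, r := Finset.sum_le_sum fun i _ => min_le_right _ _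
      _ = K * r := by simp
  have hfull : ∀ n, K * r ≤ Φ n → ∀ i, r ≤ N i n := by
    intro n hn i
    by_contra! hi
    have : Φ n < ∑ _i : Fin K, r := Finset.sum_lt_sum (fun i _ => min_le_right _ _)
      ⟨i, Finset.mem_univ i, by simpa using hi⟩
    simp at this
    omega
  -- Until the potential is full, each active sample raises it, except those taken with at most `s`
  -- active predecessors; there are at most `s + 1` of these.
  have key : ∀ n, K * r ≤ Φ n ∨ ((Finset.range n).filter b).card ≤ s + 1 + Φ n := by
    intro n
    induction n with
    | zero => right; simp
    | succ n ih =>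
      have hm := hmono n
      rcases ih with h1 | h1
      · exact Or.inl (h1.trans hm)
      by_cases h2 : K * r ≤ Φ n
      · exact Or.inl (h2.trans hm)
      right
      rw [card_filter_range_succ]
      split_ifs with hb
      · by_cases h3 : s < ((Finset.range n).filter b).card
        · obtain ⟨i, hi⟩ : ∃ i, N i n < r := by
            by_contra! hall
            apply h2
            calc K * r = ∑ _i : Fin K, r := by simp
              _ ≤ Φ n := Finset.sum_le_sum fun i _ => le_min (hall i) le_rfl
          -- The chosen arm has the least count, so its count is below `r` and its truncated count
          -- really increases.
          have h4 : N (arm n) n < r := (h n hb h3 ⟨i, hi⟩ i).trans_lt hi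
          have h5 : Φ n < Φ (n + 1) := by
            refine Finset.sum_lt_sum (fun i _ => min_le_min_right _ (by rw [hNsucc]; omega))
              ⟨arm n, Finset.mem_univ _, ?_⟩
            rw [hNsucc, if_pos ⟨hb, rfl⟩]
            omega
          omega
        · omega
      · omega
  refine hfull n ?_ i
  rcases key n with h1 | h1
  · exact h1
  · have := hle n
    omega

end Greedy

/-! ### Bounds for averaged and maximum likelihoods -/

theorem exists_pos_forall_le {ι : Type*} [Finite ι] (f : ι → ℝ) (hf : ∀ i, 0 < f i) :
    ∃ c > 0, ∀ i, c ≤ f i := by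
  rcases isEmpty_or_nonempty ι with h | h
  · exact ⟨1, one_pos, fun i => isEmptyElim i⟩
  · obtain ⟨i, hi⟩ := Finite.exists_min f
    exact ⟨f i, hf i, hi⟩

theorem exists_ofReal_le_of_pos {x : ℝ≥0∞} (hx : 0 < x) : ∃ q : ℝ, 0 < q ∧ ENNReal.ofReal q ≤ x := by
  obtain ⟨q, hq0, hq⟩ := ENNReal.lt_iff_exists_nnreal_btwn.1 hx
  exact ⟨q, by exact_mod_cast hq0, by simpa using hq.le⟩

/-- The Lebesgue measure on the affine hull of a relatively open set `S` gives to small balls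
around a point of `S` a mass that is at least polynomial in the radius. -/
theorem exists_le_affineLebesgue {E : Type*} [NormedAddCommGroup E] [NormedSpace ℝ E]
    [FiniteDimensional ℝ E] [MeasurableSpace E] [BorelSpace E] {S : Set E}
    (hS : intrinsicInterior ℝ S = S) {x : E} (hx : x ∈ S) :
    ∃ q > 0, ∃ D : ℕ, ∃ r > 0, ∀ s, 0 < s → s ≤ r →
      ENNReal.ofReal (q * s ^ D) ≤ affineLebesgue S (S ∩ Metric.closedBall x s) := by
  obtain ⟨r, hr, hball⟩ := exists_ball_inter_affineSpan_subset hS hx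
  have hne : S.Nonempty := ⟨x, hx⟩
  let μ := (Module.finBasis ℝ (vectorSpan ℝ S)).addHaar
  obtain ⟨q, hq, hqμ⟩ := exists_ofReal_le_of_pos
    (Metric.measure_ball_pos μ (0 : vectorSpan ℝ S) one_pos)
  refine ⟨q, hq, Module.finrank ℝ (vectorSpan ℝ S), r, hr, fun s hs hsr => ?_⟩
  have hmeas : Measurable fun v : vectorSpan ℝ S => (v : E) + hne.some :=
    (continuous_subtype_val.add continuous_const).measurable
  have hcS : hne.some ∈ affineSpan ℝ S := subset_affineSpan ℝ S hne.some_mem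
  have hv : x - hne.some ∈ vectorSpan ℝ S := by
    rw [← vsub_eq_sub]
    exact vsub_mem_vectorSpan ℝ hx hne.some_mem
  have hsub : Metric.ball (⟨x - hne.some, hv⟩ : vectorSpan ℝ S) s ⊆
      (fun v : vectorSpan ℝ S => (v : E) + hne.some) ⁻¹' (S ∩ Metric.closedBall x s) := by
    intro v hvs
    rw [Metric.mem_ball, Subtype.dist_eq, dist_eq_norm] at hvs
    have hnorm : ‖(v : E) + hne.some - x‖ < s := by
      rwa [show (v : E) + hne.some - x = v - (x - hne.some) by abel]
    refine ⟨hball _ ?_ (hnorm.trans_le hsr), ?_⟩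
    · change (v : E) +ᵥ hne.some ∈ affineSpan ℝ S
      exact AffineSubspace.vadd_mem_of_mem_direction
        (by rw [direction_affineSpan]; exact v.2) hcS
    · rw [Metric.mem_closedBall, dist_eq_norm]
      exact hnorm.le
  rw [affineLebesgue, dif_pos hne, Measure.map_apply hmeas
    ((measurableSet_of_intrinsicInterior_eq hS).inter Metric.isClosed_closedBall.measurableSet)]
  refine le_trans ?_ (measure_mono hsub)
  -- Scaling of Haar measure produces the power `s ^ D`, with `D` the dimension of the affine hull.
  rw [Measure.addHaar_ball_of_pos _ _ hs, mul_comm q, ENNReal.ofReal_mul (by positivity)]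
  gcongr

namespace Problem

variable {K M : ℕ} {d : Fin K → ℕ} (𝓑 : Problem K M d)

theorem isOpen_naturalSpace : IsOpen 𝓑.naturalSpace := by
  have : 𝓑.naturalSpace = ⋂ i, (fun η : Param d => η i) ⁻¹' (𝓑.arm i).Ψ := by
    ext η; simp [naturalSpace]
  rw [this]
  exact isOpen_iInter_of_finite fun i => (𝓑.arm i).isOpen_Ψ.preimage (continuous_apply i)

theorem sampleCount_le {n : ℕ} (a : Fin n → Fin K) (i : Fin K) : sampleCount a i ≤ n :=
  (Finset.card_filter_le _ _).trans (by simp)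

/-- Near `η` the continuous, positive kernel stays above half its value at `η`, so the polynomial
bound for Lebesgue measure passes to the prior. Finiteness of the prior mass makes the normalising
factor positive. -/
theorem exists_le_prior {Υ : Param d} {n₀ : Fin K → ℝ} (hprior : 𝓑.IsProperPrior Υ n₀) {l : Fin M}
    {η : Param d} (hη : η ∈ 𝓑.Θ l) : ∃ q > 0, ∃ D : ℕ, ∃ r > 0, ∀ s, 0 < s → s ≤ r →
      ENNReal.ofReal (q * s ^ D) ≤ 𝓑.prior Υ n₀ l (𝓑.Θ l ∩ Metric.closedBall η s) := by
  obtain ⟨q, hq, D, r, hr, h⟩ := exists_le_affineLebesgue (𝓑.relOpen_Θ l) hη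
  have hcont : ContinuousAt (fun η : Param d =>
      ∏ i, Real.exp (⟪η i, Υ i⟫ - n₀ i * (𝓑.arm i).A (η i))) η := by
    refine ContinuousOn.continuousAt ?_
      (𝓑.isOpen_naturalSpace.mem_nhds (𝓑.Θ_subset_naturalSpace l hη))
    refine continuousOn_finsetProd _ fun i _ => ?_
    have := 𝓑.continuousOn_A_apply i
    fun_prop
  have hpos : 0 < ∏ i, Real.exp (⟪η i, Υ i⟫ - n₀ i * (𝓑.arm i).A (η i)) :=
    Finset.prod_pos fun i _ => Real.exp_pos _
  obtain ⟨r', hr', hball⟩ := Metric.nhds_basis_closedBall.mem_iff.1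
    (hcont.eventually (lt_mem_nhds (half_lt_self hpos)))
  set k := (∏ i, Real.exp (⟪η i, Υ i⟫ - n₀ i * (𝓑.arm i).A (η i))) / 2 with hk
  have hk0 : 0 < k := half_pos hpos
  obtain ⟨p, hp, hpm⟩ := exists_ofReal_le_of_pos (ENNReal.inv_pos.2 (hprior l).ne)
  refine ⟨p * k * q, by positivity, D, min r r', lt_min hr hr', fun s hs hsr => ?_⟩
  have hms : MeasurableSet (𝓑.Θ l ∩ Metric.closedBall η s) :=
    (𝓑.measurableSet_Θ l).inter Metric.isClosed_closedBall.measurableSet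
  rw [prior, withDensity_apply _ hms, Measure.restrict_restrict hms,
    Set.inter_eq_left.2 Set.inter_subset_left]
  calc ENNReal.ofReal (p * k * q * s ^ D)
      = ENNReal.ofReal p * ENNReal.ofReal k * ENNReal.ofReal (q * s ^ D) := by
        rw [← ENNReal.ofReal_mul hp.le, ← ENNReal.ofReal_mul (by positivity), mul_assoc (p * k)]
    _ ≤ ENNReal.ofReal p * ENNReal.ofReal k *
        affineLebesgue (𝓑.Θ l) (𝓑.Θ l ∩ Metric.closedBall η s) := by
        gcongr
        exact h s hs (hsr.trans (min_le_left _ _))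
    _ = ∫⁻ _ in 𝓑.Θ l ∩ Metric.closedBall η s, ENNReal.ofReal p * ENNReal.ofReal k
          ∂affineLebesgue (𝓑.Θ l) := by rw [setLIntegral_const]
    _ ≤ _ := by
        refine setLIntegral_mono' hms fun η' hη' => ?_
        gcongr
        exact ENNReal.ofReal_le_ofReal (le_of_lt (hball
          (Metric.closedBall_subset_closedBall (hsr.trans (min_le_right _ _)) hη'.2)))

/-- A lower bound for the averaged likelihood of the true hypothesis. -/
theorem exists_le_avgLikelihood {Υ : Param d} {n₀ : Fin K → ℝ} (hprior : 𝓑.IsProperPrior Υ n₀)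
    {l : Fin M} {η : Param d} (hη : η ∈ 𝓑.Θ l) :
    ∃ q > 0, ∃ D : ℕ, ∃ r > 0, ∃ C ≥ 0, ∀ s, 0 < s → s ≤ r →
      ∀ (n : ℕ) (a : Fin n → Fin K) (x : Fin n → ℝ) (R : ℝ),
        (∀ i, ‖𝓑.noise η a x i‖ ≤ R) →
        ENNReal.ofReal (𝓑.likelihood a x η * Real.exp (-(K * (s * R + n * (C * s ^ 2)))) *
          (q * s ^ D)) ≤ 𝓑.avgLikelihood Υ n₀ a x l := by
  obtain ⟨q, hq, D, r, hr, h⟩ := 𝓑.exists_le_prior hprior hη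
  have hηΨ := 𝓑.mem_Ψ l η hη
  choose ρ hρ C hC hbr using fun i => ExpFamily.exists_bregman_le (hηΨ i)
  obtain ⟨ρ', hρ', hle⟩ := exists_pos_forall_le ρ hρ
  have hCsum : ∀ i, C i ≤ ∑ j, C j :=
    fun i => Finset.single_le_sum (fun j _ => hC j) (Finset.mem_univ i)
  refine ⟨q, hq, D, min r ρ', lt_min hr hρ', ∑ j, C j, Finset.sum_nonneg fun j _ => hC j,
    fun s hs hsr n a x R hR => ?_⟩
  have hlik := 𝓑.likelihood_nonneg a x η
  have hms : MeasurableSet (𝓑.Θ l ∩ Metric.closedBall η s) :=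
    (𝓑.measurableSet_Θ l).inter Metric.isClosed_closedBall.measurableSet
  rw [𝓑.avgLikelihood_eq, ENNReal.ofReal_mul (by positivity)]
  -- Only the ball of radius `s` around `η` is kept; on it each arm loses at most `s * R` from the
  -- noise and `n * C * s ^ 2` from the divergence.
  calc _ ≤ ENNReal.ofReal (𝓑.likelihood a x η *
          Real.exp (-(K * (s * R + n * ((∑ j, C j) * s ^ 2))))) *
          𝓑.prior Υ n₀ l (𝓑.Θ l ∩ Metric.closedBall η s) := by
        gcongr
        exact h s hs (hsr.trans (min_le_left _ _))
    _ ≤ ∫⁻ η' in 𝓑.Θ l ∩ Metric.closedBall η s, ENNReal.ofReal (𝓑.likelihood a x η')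
          ∂𝓑.prior Υ n₀ l := by
        rw [← setLIntegral_const]
        refine setLIntegral_mono' hms fun η' hη' => ENNReal.ofReal_le_ofReal ?_
        rw [𝓑.likelihood_eq_noise a x η η']
        gcongr
        have hterm : ∀ i, -(s * R + n * ((∑ j, C j) * s ^ 2)) ≤
            ⟪η' i - η i, 𝓑.noise η a x i⟫ -
              sampleCount a i * (𝓑.arm i).bregman (η i) (η' i) := by
          intro i
          have hu : ‖η' i - η i‖ ≤ s := by
            have := (dist_le_pi_dist η' η i).trans hη'.2
            rwa [dist_eq_norm] at this
          have h1 : -(s * R) ≤ ⟪η' i - η i, 𝓑.noise η a x i⟫ := by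
            have := (abs_le.1 (abs_real_inner_le_norm (η' i - η i) (𝓑.noise η a x i))).1
            have h2 : ‖η' i - η i‖ * ‖𝓑.noise η a x i‖ ≤ s * R := by
              gcongr
              exact hR i
            linarith
          have h2 := (hbr i (η' i) (hu.trans ((hsr.trans (min_le_right _ _)).trans (hle i)))).2
          have h3 : C i * ‖η' i - η i‖ ^ 2 ≤ (∑ j, C j) * s ^ 2 := by
            gcongr
            · exact Finset.sum_nonneg fun j _ => hC j
            · exact hCsum i
          have h4 : (sampleCount a i : ℝ) * (𝓑.arm i).bregman (η i) (η' i) ≤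
              n * ((∑ j, C j) * s ^ 2) := by
            refine (mul_le_mul_of_nonneg_left (h2.trans h3) (Nat.cast_nonneg _)).trans ?_
            have : (sampleCount a i : ℝ) ≤ n := by exact_mod_cast sampleCount_le a i
            have := Finset.sum_nonneg fun j (_ : j ∈ Finset.univ) => hC j
            gcongr
          linarith
        calc _ = ∑ _i : Fin K, -(s * R + n * ((∑ j, C j) * s ^ 2)) := by simp; ring
          _ ≤ _ := Finset.sum_le_sum fun i _ => hterm i
    _ ≤ _ := setLIntegral_le_lintegral _ _

/-- An upper bound for the maximum likelihood of a separated hypothesis. -/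
theorem exists_maxLikelihood_le {m : Fin M} {η : Param d} (hη : η ∈ 𝓑.naturalSpace)
    (hsep : η ∉ closure (𝓑.Θ m)) :
    ∃ r > 0, ∃ κ > 0, ∀ (n : ℕ) (a : Fin n → Fin K) (x : Fin n → ℝ) (R N : ℝ),
      (∀ i, ‖𝓑.noise η a x i‖ ≤ R) → (∀ i, N ≤ sampleCount a i) → 0 ≤ R → R ≤ κ * N →
      𝓑.maxLikelihood a x m ≤
        ENNReal.ofReal (𝓑.likelihood a x η * Real.exp (K * (r * R) - r * (κ * N))) := by
  obtain ⟨r, hr, hball⟩ : ∃ r > 0, ∀ η' ∈ 𝓑.Θ m, r ≤ dist η' η := by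
    rw [Metric.mem_closure_iff] at hsep
    push Not at hsep
    obtain ⟨r, hr, h⟩ := hsep
    exact ⟨r, hr, fun η' hη' => by rw [dist_comm]; exact h η' hη'⟩
  choose c hc hbr using fun i => ExpFamily.exists_mul_norm_le_bregman (hη i) hr
  obtain ⟨c', hc', hle⟩ := exists_pos_forall_le c hc
  -- For an arm far from `η`, half of the linear growth of the divergence absorbs the noise; the
  -- other half is the gain.
  refine ⟨r, hr, c' / 2, half_pos hc', fun n a x R N hR hN hR0 hRN => ?_⟩
  refine iSup₂_le fun η' hη' => ENNReal.ofReal_le_ofReal ?_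
  have hΨ := 𝓑.mem_Ψ m η' hη'
  rw [𝓑.likelihood_eq_noise a x η η']
  have hlik := 𝓑.likelihood_nonneg a x η
  gcongr
  obtain ⟨i₀, hi₀⟩ : ∃ i, r ≤ ‖η' i - η i‖ := by
    by_contra! hcon
    refine (hball η' hη').not_gt ((dist_pi_lt_iff hr).2 fun i => ?_)
    rw [dist_eq_norm]
    exact hcon i
  have hinner : ∀ i, ⟪η' i - η i, 𝓑.noise η a x i⟫ ≤ ‖η' i - η i‖ * R := fun i =>
    (real_inner_le_norm _ _).trans (by gcongr; exact hR i)
  have hfar : ∀ i, r ≤ ‖η' i - η i‖ → ⟪η' i - η i, 𝓑.noise η a x i⟫ -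
      sampleCount a i * (𝓑.arm i).bregman (η i) (η' i) ≤ -(r * (c' / 2 * N)) := by
    intro i hi
    have hN0 : 0 ≤ c' / 2 * N := hR0.trans hRN
    have h1 : c' * ‖η' i - η i‖ ≤ (𝓑.arm i).bregman (η i) (η' i) :=
      (mul_le_mul_of_nonneg_right (hle i) (norm_nonneg _)).trans (hbr i (η' i) (hΨ i) hi)
    have h2 : N * (c' * ‖η' i - η i‖) ≤ sampleCount a i * (𝓑.arm i).bregman (η i) (η' i) :=
      (mul_le_mul_of_nonneg_right (hN i) (by positivity)).trans
        (mul_le_mul_of_nonneg_left h1 (Nat.cast_nonneg _))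
    have h3 := hinner i
    have h4 : ‖η' i - η i‖ * R ≤ ‖η' i - η i‖ * (c' / 2 * N) := by gcongr
    have h5 : r * (c' / 2 * N) ≤ ‖η' i - η i‖ * (c' / 2 * N) := by gcongr
    linarith
  -- Every arm may cost `r * R`, and only the gain of the far arm `i₀` is kept.
  have hterm : ∀ i, ⟪η' i - η i, 𝓑.noise η a x i⟫ -
      sampleCount a i * (𝓑.arm i).bregman (η i) (η' i) ≤
        r * R - if i = i₀ then r * (c' / 2 * N) else 0 := by
    intro i
    have hrR : 0 ≤ r * R := by positivity
    by_cases hi : r ≤ ‖η' i - η i‖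
    · have h1 := hfar i hi
      have h2 : 0 ≤ r * (c' / 2 * N) := mul_nonneg hr.le (hR0.trans hRN)
      split_ifs <;> linarith
    · rw [if_neg (by rintro rfl; exact hi hi₀), sub_zero]
      have h1 : ‖η' i - η i‖ * R ≤ r * R := by
        gcongr
        exact (not_le.1 hi).le
      have h2 : 0 ≤ (sampleCount a i : ℝ) * (𝓑.arm i).bregman (η i) (η' i) :=
        mul_nonneg (Nat.cast_nonneg _) (ExpFamily.bregman_nonneg (hη i) (hΨ i))
      have := hinner i
      linarith
  refine (Finset.sum_le_sum fun i _ => hterm i).trans_eq ?_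
  simp [Finset.sum_sub_distrib]

end Problem

namespace Problem

variable {K M : ℕ} {d : Fin K → ℕ} (𝓑 : Problem K M d)

/-- A deterministic comparison of rates. With balls of radius `1 / n`, the prior mass, the noise and
the threshold contribute exponents of order at most `n ^ θ`, against the gain of order `n ^ b` for
every alternative. -/
theorem eventually_log_le_modGLR {Υ : Param d} {n₀ : Fin K → ℝ} (hprior : 𝓑.IsProperPrior Υ n₀)
    {l : Fin M} {η : Param d} (hη : η ∈ 𝓑.Θ l) (hsep : ∀ m, m ≠ l → η ∉ closure (𝓑.Θ m))
    (a : (n : ℕ) → Fin n → Fin K) (x : (n : ℕ) → Fin n → ℝ) {θ b : ℝ} (hθ : 0 < θ) (hb : θ < b)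
    (hlik : ∀ n, 0 < 𝓑.likelihood (a n) (x n) η)
    (hN : ∀ᶠ n : ℕ in atTop, ∀ i, (n : ℝ) ^ b ≤ sampleCount (a n) i)
    (hW : ∀ᶠ n : ℕ in atTop, ∀ i, ‖𝓑.noise η (a n) (x n) i‖ ≤ (n : ℝ) ^ θ) {c : ℝ} (hc : 0 < c) :
    ∀ᶠ n : ℕ in atTop, ((Real.log c : ℝ) : EReal) ≤ 𝓑.modGLR Υ n₀ (a n) (x n) l := by
  obtain ⟨q, hq, D, ρ, hρ, C, hC, hlow⟩ := 𝓑.exists_le_avgLikelihood hprior hη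
  have hpair : ∀ m : {m : Fin M // m ≠ l}, ∀ᶠ n : ℕ in atTop,
      ((Real.log c : ℝ) : EReal) ≤ 𝓑.pairGLR Υ n₀ (a n) (x n) l m := by
    rintro ⟨m, hm⟩
    obtain ⟨r, hr, κ, hκ, hup⟩ :=
      𝓑.exists_maxLikelihood_le (𝓑.Θ_subset_naturalSpace l hη) (hsep m hm)
    have hs : Tendsto (fun n : ℕ => ((n : ℝ))⁻¹) atTop (𝓝 0) :=
      tendsto_inv_atTop_nhds_zero_nat
    filter_upwards [hN, hW, hs.eventually_le_const hρ, eventually_ge_atTop 1,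
      eventually_const_mul_rpow_le (1 / κ) hb,
      -- The constant collects all lower-order terms, each bounded by a multiple of `n ^ θ`; `D / θ`
      -- comes from `log n ≤ n ^ θ / θ`.
      eventually_const_mul_rpow_le ((|Real.log c| + |Real.log q| + K * r + K + K * C + D / θ) /
        (r * κ)) hb] with n hNn hWn hsn hn h1 h2
    have hn1 : (1 : ℝ) ≤ n := by exact_mod_cast hn
    have hn0 : (0 : ℝ) < n := by linarith
    have hone : 1 ≤ (n : ℝ) ^ θ := Real.one_le_rpow hn1 hθ.le
    have hmax := hup n (a n) (x n) ((n : ℝ) ^ θ) ((n : ℝ) ^ b) hWn hNn (by positivity)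
      (by rwa [one_div_mul_eq_div, div_le_iff₀ hκ, mul_comm] at h1)
    have havg := hlow _ (inv_pos.2 hn0) hsn n (a n) (x n) ((n : ℝ) ^ θ) hWn
    have hreal : c * Real.exp (K * (r * (n : ℝ) ^ θ) - r * (κ * (n : ℝ) ^ b)) ≤
        Real.exp (-(K * ((n : ℝ)⁻¹ * (n : ℝ) ^ θ + n * (C * (n : ℝ)⁻¹ ^ 2)))) *
          (q * (n : ℝ)⁻¹ ^ D) := by
      have hexp : q * (n : ℝ)⁻¹ ^ D = Real.exp (Real.log q - D * Real.log n) := by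
        rw [Real.exp_sub, Real.exp_log hq, mul_comm (D : ℝ), Real.exp_mul, Real.exp_log hn0,
          Real.rpow_natCast, inv_pow, div_eq_mul_inv]
      rw [hexp, ← Real.exp_add, ← Real.exp_log hc, ← Real.exp_add, Real.exp_le_exp]
      rw [div_mul_eq_mul_div, div_le_iff₀ (by positivity)] at h2
      have h3 : Real.log n ≤ (n : ℝ) ^ θ / θ := Real.log_le_rpow_div hn0.le hθ
      have h4 : (D : ℝ) * Real.log n ≤ D / θ * (n : ℝ) ^ θ := by
        calc (D : ℝ) * Real.log n ≤ D * ((n : ℝ) ^ θ / θ) := by gcongr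
          _ = _ := by ring
      have h5 : (n : ℝ)⁻¹ ≤ 1 := inv_le_one_of_one_le₀ hn1
      have h6 : (n : ℝ)⁻¹ * (n : ℝ) ^ θ ≤ (n : ℝ) ^ θ :=
        mul_le_of_le_one_left (by positivity) h5
      have h7 : n * (C * (n : ℝ)⁻¹ ^ 2) ≤ C * (n : ℝ) ^ θ := by
        have : n * (C * (n : ℝ)⁻¹ ^ 2) = C * (n : ℝ)⁻¹ := by field_simp
        rw [this]
        gcongr
        exact h5.trans hone
      have h8 : (K : ℝ) * ((n : ℝ)⁻¹ * (n : ℝ) ^ θ + n * (C * (n : ℝ)⁻¹ ^ 2)) ≤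
          K * ((n : ℝ) ^ θ + C * (n : ℝ) ^ θ) := by gcongr
      have h9 : Real.log c ≤ |Real.log c| * (n : ℝ) ^ θ :=
        (le_abs_self _).trans (le_mul_of_one_le_right (abs_nonneg _) hone)
      have h10 : -Real.log q ≤ |Real.log q| * (n : ℝ) ^ θ :=
        (neg_le_abs _).trans (le_mul_of_one_le_right (abs_nonneg _) hone)
      linarith
    have hcmp : ENNReal.ofReal c * 𝓑.maxLikelihood (a n) (x n) m ≤
        𝓑.avgLikelihood Υ n₀ (a n) (x n) l := by
      refine (mul_le_mul_right hmax _).trans (le_trans ?_ havg)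
      rw [← ENNReal.ofReal_mul hc.le]
      refine ENNReal.ofReal_le_ofReal ?_
      have := mul_le_mul_of_nonneg_left hreal (hlik n).le
      linarith
    have hpos : 𝓑.avgLikelihood Υ n₀ (a n) (x n) l ≠ 0 := by
      refine (lt_of_lt_of_le (ENNReal.ofReal_pos.2 ?_) havg).ne'
      have := hlik n
      positivity
    rw [pairGLR, ← ENNReal.log_ofReal_of_pos hc, ENNReal.log_le_log_iff,
      ENNReal.le_div_iff_mul_le (Or.inr hpos)
        (Or.inl (hmax.trans_lt ENNReal.ofReal_lt_top).ne)]
    exact hcmp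
  filter_upwards [eventually_all.2 hpair] with n hn
  exact le_iInf hn

end Problem

/-! ### Almost sure size of the noise -/

section Noise

variable {K M : ℕ} [NeZero K] {d : Fin K → ℕ} {π : Policy K M} (𝓑 : Problem K M d)

/-- Markov's inequality for a likelihood ratio, as the change of measure with a point mass at `η'`
in place of the prior. -/
theorem prob_mul_likelihood_le (hπ : π.IsMeasurable) {η η' : Param d} (hη : η ∈ 𝓑.naturalSpace)
    (hη' : η' ∈ 𝓑.naturalSpace) (n : ℕ) {c : ℝ} (hc : 0 < c) :
    π.prob 𝓑 η {ω | c * 𝓑.likelihood (π.arms ω n) (π.obs ω n) η ≤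
      𝓑.likelihood (π.arms ω n) (π.obs ω n) η'} ≤ ENNReal.ofReal c⁻¹ := by
  have hm : ∀ (a : Fin n → Fin K) (η : Param d), Measurable fun x => 𝓑.likelihood a x η :=
    fun a η => (𝓑.measurable_likelihood_uncurry a).comp (measurable_prodMk_left (x := η))
  have := Policy.mul_prob_le_lintegral_prob 𝓑 hπ (n := n)
    (D := {ω | c * 𝓑.likelihood (π.arms ω n) (π.obs ω n) η ≤
      𝓑.likelihood (π.arms ω n) (π.obs ω n) η'})
    (hπ.measurableSet_history n (P := fun a x => c * 𝓑.likelihood a x η ≤ 𝓑.likelihood a x η')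
      fun a => measurableSet_le ((hm a η).const_mul c) (hm a η'))
    (Policy.isAdapted_history n fun a x => c * 𝓑.likelihood a x η ≤ 𝓑.likelihood a x η') hη
    (w := Measure.dirac η')
    ((ae_dirac_iff 𝓑.isOpen_naturalSpace.measurableSet).2 hη') (ENNReal.ofReal c) fun ω hω => by
      rw [lintegral_dirac, ← ENNReal.ofReal_mul hc.le]
      exact ENNReal.ofReal_le_ofReal hω
  rw [lintegral_dirac] at this
  have hP := π.isProbabilityMeasure_prob_of_mem 𝓑 hη'
  rw [ENNReal.ofReal_inv_of_pos hc, ENNReal.le_inv_iff_mul_le, mul_comm]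
  exact this.trans prob_le_one

/-- Borel-Cantelli shows that the likelihood ratio of `η + n ^ (-1/2) w` to `η` is eventually below
`n ^ 2`. Its logarithm is `n ^ (-1/2)` times the noise, minus a bounded divergence term, so the
noise is at most `√n * (2 log n + C)`. -/
theorem ae_eventually_inner_noise_le (hπ : π.IsMeasurable) {η : Param d}
    (hη : η ∈ 𝓑.naturalSpace) (i : Fin K) {w : EuclideanSpace ℝ (Fin (d i))} (hw : ‖w‖ ≤ 1)
    {θ : ℝ} (hθ : 1 / 2 < θ) :
    ∀ᵐ ω ∂π.prob 𝓑 η, (∀ n, 0 < 𝓑.likelihood (π.arms ω n) (π.obs ω n) η) →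
      ∀ᶠ n : ℕ in atTop, ⟪w, 𝓑.noise η (π.arms ω n) (π.obs ω n) i⟫ ≤ (n : ℝ) ^ θ := by
  obtain ⟨r, hr, C, hC, hbr⟩ := ExpFamily.exists_bregman_le (hη i)
  -- At this scale up to `n` samples of divergence at most `C * s ^ 2` add up to at most `C`.
  set s : ℕ → ℝ := fun n => (√n)⁻¹ with hs
  set η' : ℕ → Param d := fun n => Function.update η i (η i + s n • w) with hη'def
  have hsmall : ∀ᶠ n : ℕ in atTop, s n ≤ r := by
    have : Tendsto s atTop (𝓝 0) :=
      (Real.tendsto_sqrt_atTop.comp tendsto_natCast_atTop_atTop).inv_tendsto_atTop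
    exact this.eventually_le_const hr
  obtain ⟨n₁, hn₁⟩ := eventually_atTop.1 (hsmall.and (eventually_ge_atTop 1))
  have hnorm : ∀ n, n₁ ≤ n → ‖η i + s n • w - η i‖ ≤ s n := fun n _ => by
    have hs0 : 0 ≤ s n := by positivity
    rw [add_sub_cancel_left, norm_smul, Real.norm_of_nonneg hs0]
    exact mul_le_of_le_one_right hs0 hw
  have hmem : ∀ n, n₁ ≤ n → η' n ∈ 𝓑.naturalSpace := fun n hn k => by
    by_cases hk : k = i
    · subst hk
      simp only [hη'def, Function.update_self]
      exact (hbr _ ((hnorm n hn).trans (hn₁ n hn).1)).1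
    · simp only [hη'def, Function.update_of_ne hk]
      exact hη k
  have hsum : ∑' n : ℕ, π.prob 𝓑 η {ω | n₁ ≤ n ∧
      (n : ℝ) ^ 2 * 𝓑.likelihood (π.arms ω n) (π.obs ω n) η ≤
        𝓑.likelihood (π.arms ω n) (π.obs ω n) (η' n)} ≠ ∞ := by
    have hb : ∀ n : ℕ, π.prob 𝓑 η {ω | n₁ ≤ n ∧
        (n : ℝ) ^ 2 * 𝓑.likelihood (π.arms ω n) (π.obs ω n) η ≤
          𝓑.likelihood (π.arms ω n) (π.obs ω n) (η' n)} ≤ ENNReal.ofReal (((n : ℝ) ^ 2)⁻¹) := by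
      intro n
      by_cases hn : n₁ ≤ n
      · have : 0 < n := (hn₁ n hn).2
        refine le_trans (measure_mono fun ω hω => hω.2)
          (prob_mul_likelihood_le 𝓑 hπ hη (hmem n hn) n (by positivity))
      · simp [hn]
    exact ne_top_of_le_ne_top
      (Real.summable_nat_pow_inv.2 one_lt_two).tsum_ofReal_ne_top (ENNReal.tsum_le_tsum hb)
  obtain ⟨δ, hδ, hδθ⟩ : ∃ δ > 0, 1 / 2 + δ < θ := ⟨(θ - 1 / 2) / 2, by linarith, by linarith⟩
  filter_upwards [ae_eventually_notMem hsum] with ω hω hlik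
  filter_upwards [hω, eventually_ge_atTop n₁,
    eventually_const_mul_rpow_le (2 / δ + C) hδθ] with n h1 hn h2
  have hn1 : (1 : ℝ) ≤ n := by exact_mod_cast (hn₁ n hn).2
  have hn0 : (0 : ℝ) < n := by linarith
  have h3 : 𝓑.likelihood (π.arms ω n) (π.obs ω n) (η' n) <
      (n : ℝ) ^ 2 * 𝓑.likelihood (π.arms ω n) (π.obs ω n) η := by
    by_contra! hcon
    exact h1 ⟨hn, hcon⟩
  rw [𝓑.likelihood_eq_noise _ _ η, mul_comm ((n : ℝ) ^ 2), mul_lt_mul_iff_right₀ (hlik n),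
    Finset.sum_eq_single i (fun k _ hk => by simp [hη'def, Function.update_of_ne hk]) (by simp),
    ← Real.lt_log_iff_exp_lt (by positivity), Real.log_pow] at h3
  simp only [hη'def, Function.update_self, add_sub_cancel_left, real_inner_smul_left] at h3
  set X := ⟪w, 𝓑.noise η (π.arms ω n) (π.obs ω n) i⟫
  have hsqrt : 0 < √(n : ℝ) := Real.sqrt_pos.2 hn0
  have h4 : (sampleCount (π.arms ω n) i : ℝ) *
      (𝓑.arm i).bregman (η i) (η i + s n • w) ≤ C := by
    have h5 := (hbr _ ((hnorm n hn).trans (hn₁ n hn).1)).2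
    have h6 : C * ‖η i + s n • w - η i‖ ^ 2 ≤ C * (n : ℝ)⁻¹ := by
      have : (n : ℝ)⁻¹ = s n ^ 2 := by rw [hs, inv_pow, Real.sq_sqrt hn0.le]
      rw [this]
      gcongr
      exact hnorm n hn
    have h7 : (sampleCount (π.arms ω n) i : ℝ) ≤ n := by exact_mod_cast Problem.sampleCount_le _ i
    calc _ ≤ (sampleCount (π.arms ω n) i : ℝ) * (C * (n : ℝ)⁻¹) := by
          gcongr
          exact h5.trans h6
      _ ≤ n * (C * (n : ℝ)⁻¹) := by gcongr
      _ = C := by field_simp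
  have h5 : X ≤ √n * (2 * Real.log n + C) := by
    have : (√(n : ℝ))⁻¹ * X ≤ 2 * Real.log n + C := by
      push_cast at h3
      linarith
    rwa [inv_mul_le_iff₀ hsqrt] at this
  refine h5.trans (le_trans ?_ h2)
  have h6 : Real.log n ≤ (n : ℝ) ^ δ / δ := Real.log_le_rpow_div hn0.le hδ
  have h7 : 1 ≤ (n : ℝ) ^ δ := Real.one_le_rpow hn1 hδ.le
  rw [Real.rpow_add hn0, ← Real.sqrt_eq_rpow]
  calc √n * (2 * Real.log n + C) ≤ √n * (2 * ((n : ℝ) ^ δ / δ) + C * (n : ℝ) ^ δ) := by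
        gcongr
        exact le_mul_of_one_le_right hC h7
    _ = _ := by ring

/-- One-sided bounds along plus and minus each basis vector control all coordinates; the gap between
`θ'` and `θ` absorbs the dimension. -/
theorem ae_eventually_norm_noise_le (hπ : π.IsMeasurable) {η : Param d}
    (hη : η ∈ 𝓑.naturalSpace) {θ : ℝ} (hθ : 1 / 2 < θ) :
    ∀ᵐ ω ∂π.prob 𝓑 η, (∀ n, 0 < 𝓑.likelihood (π.arms ω n) (π.obs ω n) η) →
      ∀ᶠ n : ℕ in atTop, ∀ i, ‖𝓑.noise η (π.arms ω n) (π.obs ω n) i‖ ≤ (n : ℝ) ^ θ := by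
  obtain ⟨θ', h1, h2⟩ := exists_between hθ
  have hpos : ∀ᵐ ω ∂π.prob 𝓑 η, ∀ i, ∀ j : Fin (d i),
      (∀ n, 0 < 𝓑.likelihood (π.arms ω n) (π.obs ω n) η) → ∀ᶠ n : ℕ in atTop,
        ⟪EuclideanSpace.single j (1 : ℝ), 𝓑.noise η (π.arms ω n) (π.obs ω n) i⟫ ≤ (n : ℝ) ^ θ' :=
    ae_all_iff.2 fun i => ae_all_iff.2 fun j =>
      ae_eventually_inner_noise_le 𝓑 hπ hη i (by simp) h1
  have hneg : ∀ᵐ ω ∂π.prob 𝓑 η, ∀ i, ∀ j : Fin (d i),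
      (∀ n, 0 < 𝓑.likelihood (π.arms ω n) (π.obs ω n) η) → ∀ᶠ n : ℕ in atTop,
        ⟪EuclideanSpace.single j (-1 : ℝ), 𝓑.noise η (π.arms ω n) (π.obs ω n) i⟫ ≤
          (n : ℝ) ^ θ' :=
    ae_all_iff.2 fun i => ae_all_iff.2 fun j =>
      ae_eventually_inner_noise_le 𝓑 hπ hη i (by simp) h1
  filter_upwards [hpos, hneg] with ω hω1 hω2 hlik
  refine eventually_all.2 fun i => ?_
  filter_upwards [eventually_all.2 fun j => hω1 i j hlik, eventually_all.2 fun j => hω2 i j hlik,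
    eventually_const_mul_rpow_le (d i) h2] with n h3 h4 h5
  refine le_trans ?_ h5
  set z := 𝓑.noise η (π.arms ω n) (π.obs ω n) i
  have hz : ∀ j, ‖z j‖ ≤ (n : ℝ) ^ θ' := fun j => by
    have := h3 j
    have := h4 j
    simp only [EuclideanSpace.inner_single_left] at *
    rw [Real.norm_eq_abs, abs_le]
    constructor <;> simp at * <;> linarith
  calc ‖z‖ ≤ ∑ j, ‖z j‖ := by
        rw [EuclideanSpace.norm_eq]
        exact Real.sqrt_le_iff.2 ⟨Finset.sum_nonneg fun j _ => norm_nonneg _,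
          Finset.sum_sq_le_sq_sum_of_nonneg fun j _ => norm_nonneg _⟩
    _ ≤ ∑ _j : Fin (d i), (n : ℝ) ^ θ' := Finset.sum_le_sum fun j _ => hz j
    _ = _ := by simp

end Noise

/-! ### Almost sure properties of seeds and observations -/

namespace ExpFamily

theorem ae_density_pos {d : ℕ} (𝓔 : ExpFamily d) (η : EuclideanSpace ℝ (Fin d)) :
    ∀ᵐ x ∂𝓔.law η, 0 < 𝓔.density η x := by
  rw [law, ae_withDensity_iff (𝓔.measurable_density η).ennreal_ofReal]
  exact Eventually.of_forall fun x hx => by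
    simpa using hx

end ExpFamily

theorem ae_tieBreak_mem (k : ℕ) : ∀ᵐ ξ ∂tieBreakLaw k, ∀ S, ξ S ∈ S.1 := by
  refine ae_all_iff.2 fun S => ?_
  have h : ∀ᵐ i ∂(PMF.uniformOfFinset S.1 S.2).toMeasure, i ∈ S.1 := by
    rw [ae_iff, PMF.toMeasure_uniformOfFinset_apply _ _ (Set.toFinite _).measurableSet]
    simp
  exact (measurePreserving_eval (fun S : {S : Finset (Fin k) // S.Nonempty} =>
    (PMF.uniformOfFinset S.1 S.2).toMeasure) S).quasiMeasurePreserving.ae h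

theorem ae_stageSeed_mem (K M : ℕ) (γ : I) :
    ∀ᵐ s ∂stageSeedLaw K M γ, (∀ S, s.2.1 S ∈ S.1) ∧ ∀ S, s.2.2 S ∈ S.1 := by
  have h1 : Measure.QuasiMeasurePreserving (fun s : StageSeed K M => s.2.1)
      (stageSeedLaw K M γ) (tieBreakLaw M) :=
    Measure.quasiMeasurePreserving_fst.comp Measure.quasiMeasurePreserving_snd
  have h2 : Measure.QuasiMeasurePreserving (fun s : StageSeed K M => s.2.2)
      (stageSeedLaw K M γ) (tieBreakLaw K) :=
    Measure.quasiMeasurePreserving_snd.comp Measure.quasiMeasurePreserving_snd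
  exact (h1.ae (ae_tieBreak_mem M)).and (h2.ae (ae_tieBreak_mem K))

namespace Policy

variable {K M : ℕ} {d : Fin K → ℕ} {π : Policy K M} (𝓑 : Problem K M d) {η : Param d}

theorem ae_forall_seed (hη : η ∈ 𝓑.naturalSpace) {Q : π.Seed → Prop}
    (h : ∀ᵐ s ∂π.seedLaw, Q s) : ∀ᵐ ω ∂π.prob 𝓑 η, ∀ t, Q (ω t).1 := by
  have := fun i => (𝓑.arm i).isProbabilityMeasure_law (hη i)
  refine ae_all_iff.2 fun t => ?_
  exact (Measure.quasiMeasurePreserving_fst.comp (measurePreserving_eval_infinitePi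
    (fun _ : ℕ => π.seedLaw.prod (Measure.pi fun i => (𝓑.arm i).law (η i)))
    t).quasiMeasurePreserving).ae h

theorem ae_forall_density_pos (hη : η ∈ 𝓑.naturalSpace) :
    ∀ᵐ ω ∂π.prob 𝓑 η, ∀ t i, 0 < (𝓑.arm i).density (η i) ((ω t).2 i) := by
  have := fun i => (𝓑.arm i).isProbabilityMeasure_law (hη i)
  refine ae_all_iff.2 fun t => ae_all_iff.2 fun i => ?_
  exact ((measurePreserving_eval (fun i => (𝓑.arm i).law (η i)) i).quasiMeasurePreserving.comp
    (Measure.quasiMeasurePreserving_snd.comp (measurePreserving_eval_infinitePi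
      (fun _ : ℕ => π.seedLaw.prod (Measure.pi fun i => (𝓑.arm i).law (η i)))
      t).quasiMeasurePreserving)).ae ((𝓑.arm i).ae_density_pos (η i))

theorem ae_likelihood_pos [NeZero K] (hη : η ∈ 𝓑.naturalSpace) :
    ∀ᵐ ω ∂π.prob 𝓑 η, ∀ n, 0 < 𝓑.likelihood (π.arms ω n) (π.obs ω n) η := by
  filter_upwards [ae_forall_density_pos 𝓑 hη] with ω hω n
  exact Finset.prod_pos fun t _ => hω t _

/-- The strong law of large numbers for the frequency of an event of the seeds. -/
theorem ae_tendsto_frequency (hη : η ∈ 𝓑.naturalSpace) {f : π.Seed → Bool}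
    (hf : Measurable f) :
    ∀ᵐ ω ∂π.prob 𝓑 η, Tendsto (fun n : ℕ =>
      (((Finset.range n).filter fun t => f (ω t).1 = true).card : ℝ) / n) atTop
        (𝓝 (π.seedLaw.real {s | f s = true})) := by
  have := fun i => (𝓑.arm i).isProbabilityMeasure_law (hη i)
  have hP := π.isProbabilityMeasure_prob_of_mem 𝓑 hη
  let g : Bool → ℝ := fun c => if c then 1 else 0
  have hg : Measurable g := .of_discrete
  let X : ℕ → π.Outcome → ℝ := fun t ω => g (f (ω t).1)
  have hX : ∀ t, Measurable (X t) := fun t => by fun_prop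
  have hmp : ∀ t, MeasurePreserving (fun ω : π.Outcome => (ω t).1) (π.prob 𝓑 η) π.seedLaw :=
    fun t => measurePreserving_fst.comp (measurePreserving_eval_infinitePi
      (fun _ : ℕ => π.seedLaw.prod (Measure.pi fun i => (𝓑.arm i).law (η i))) t)
  have hident : ∀ t, (π.prob 𝓑 η).map (X t) = π.seedLaw.map fun s => g (f s) := fun t => by
    have hgf : Measurable fun s => g (f s) := hg.comp hf
    rw [← (hmp t).map_eq, Measure.map_map hgf (hmp t).measurable]
    rfl
  have hbdd : ∀ ω, ‖X 0 ω‖ ≤ 1 := fun ω => by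
    simp only [X, g]; split_ifs <;> simp
  have hindep : ProbabilityTheory.iIndepFun X (π.prob 𝓑 η) :=
    ProbabilityTheory.iIndepFun_infinitePi (X := fun _ (z : π.Seed × (Fin K → ℝ)) =>
      g (f z.1)) fun t => by fun_prop
  have hlln := ProbabilityTheory.strong_law_ae_real X
    (Integrable.of_bound (hX 0).aestronglyMeasurable 1 (Eventually.of_forall hbdd))
    (fun s t hst => hindep.indepFun hst)
    (fun t => ⟨(hX t).aemeasurable, (hX 0).aemeasurable, by rw [hident, hident]⟩)
  have hmean : ∫ ω, X 0 ω ∂π.prob 𝓑 η = π.seedLaw.real {s | f s = true} := by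
    have h1 : ∫ ω, X 0 ω ∂π.prob 𝓑 η = ∫ s, g (f s) ∂π.seedLaw := by
      have hgf : Measurable fun s => g (f s) := hg.comp hf
      rw [← (hmp 0).map_eq, integral_map (hmp 0).measurable.aemeasurable
        hgf.aestronglyMeasurable]
    have hset : MeasurableSet {s | f s = true} := hf (measurableSet_singleton true)
    rw [h1, ← integral_indicator_one hset]
    refine integral_congr_ae (Eventually.of_forall fun s => ?_)
    simp [g, Set.indicator_apply]
  rw [hmean] at hlln
  filter_upwards [hlln] with ω hω
  refine hω.congr fun n => ?_
  simp [X, g, Finset.sum_boole]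

end Policy

theorem card_filter_univ_fin (n : ℕ) (p : ℕ → Prop) [DecidablePred p] :
    ((Finset.univ : Finset (Fin n)).filter fun t : Fin n => p t).card =
      ((Finset.range n).filter p).card := by
  rw [Finset.card_filter, Finset.card_filter, Finset.sum_range]

theorem activeCount_le_sampleCount {K M : ℕ} {n : ℕ} (s : Fin (n + 1) → StageSeed K M) (a : Fin n → Fin K)
    (i : Fin K) : activeCount s a i ≤ sampleCount a i :=
  Finset.card_le_card (Finset.filter_subset_filter _ (Finset.subset_univ _))

/-! ### Almost sure stopping -/

section NeverStops

variable {K M : ℕ} [NeZero K] [NeZero M] {d : Fin K → ℕ} (𝓑 : Problem K M d)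
    {Υ : Param d} {n₀ : Fin K → ℝ}
    {est : (n : ℕ) → (Fin n → Fin K) → (Fin n → ℝ) → Fin M → Param d}
    {lam : Param d → Fin K → ℝ} {L : ℝ} {γ : I} {β : ℝ}

theorem trackingArm_le {na : ℕ} {N : Fin K → ℕ} {w : Fin K → ℝ} {ξ : TieBreak K}
    (hξ : ∀ S, ξ S ∈ S.1)
    (h : ∃ i, (N i : ℝ) < (na : ℝ) ^ β - (β * K) ^ (β / (1 - β))) (j : Fin K) :
    N (trackingArm β na N w ξ) ≤ N j := by
  rw [trackingArm, if_pos h]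
  exact mem_argminSet.1 (hξ (argminSet N)) j

theorem modGLR_lt_of_act_ne_halt {n : ℕ} {s : Fin (n + 1 + 1) → StageSeed K M}
    {a : Fin (n + 1) → Fin K} {x : Fin (n + 1) → ℝ}
    (h : ((piSMF 𝓑 Υ n₀ est lam L γ β).act (n + 1) s a x).decision? = none) :
    𝓑.modGLR Υ n₀ a x (leader 𝓑 Υ n₀ s a x) < ((Real.log ((M - 1) * L) : ℝ) : EReal) := by
  by_contra! hcon
  rw [piSMF_act_of_le 𝓑 hcon] at h
  simp [Action.decision?] at h

/-- As long as the policy does not stop, forced exploration makes the numbers of samples of all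
arms grow almost as fast as `n ^ β`. -/
theorem eventually_rpow_le_sampleCount {ω : (piSMF 𝓑 Υ n₀ est lam L γ β).Outcome}
    (hnone : ∀ n, ((piSMF 𝓑 Υ n₀ est lam L γ β).action ω n).decision? = none)
    (hξ : ∀ t S, (ω t).1.2.2 S ∈ S.1) {ρ : ℝ} (hρ : 0 < ρ)
    (hcoin : ∀ᶠ n : ℕ in atTop,
      ρ * n ≤ ((Finset.range n).filter fun t => (ω t).1.1 = true).card)
    {b : ℝ} (hb : 0 < b) (hbβ : b < β) (hβ : β < 1) :
    ∀ᶠ n : ℕ in atTop, ∀ i,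
      (n : ℝ) ^ b ≤ sampleCount ((piSMF 𝓑 Υ n₀ est lam L γ β).arms ω n) i := by
  let π := piSMF 𝓑 Υ n₀ est lam L γ β
  have hC : 0 ≤ (β * K) ^ (β / (1 - β)) :=
    Real.rpow_nonneg (mul_nonneg (hb.trans hbβ).le (Nat.cast_nonneg _)) _
  let active : ℕ → Prop := fun t => t = 0 ∨ (ω t).1.1 = true
  let arm : ℕ → Fin K := fun t => (π.action ω t).arm
  let seeds : (n : ℕ) → Fin (n + 1) → StageSeed K M := fun n t => (ω t).1
  have hactive : ∀ n, (activeTimes (seeds n)).card = ((Finset.range n).filter active).card :=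
    fun n => card_filter_univ_fin n active
  have hcount : ∀ n i, activeCount (seeds n) (π.arms ω n) i =
      ((Finset.range n).filter fun t => active t ∧ arm t = i).card := by
    intro n i
    rw [← card_filter_univ_fin n fun t => active t ∧ arm t = i, activeCount, activeTimes,
      Finset.filter_filter]
    simp only [π.arms_apply]
    rfl
  have hgreedy : ∀ t, active t → 0 < t →
      (∃ i, (activeCount (seeds t) (π.arms ω t) i : ℝ) <
        (((activeTimes (seeds t)).card + 1 : ℕ) : ℝ) ^ β - (β * K) ^ (β / (1 - β))) →
      ∀ j, activeCount (seeds t) (π.arms ω t) (arm t) ≤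
        activeCount (seeds t) (π.arms ω t) j := by
    intro t hact ht hex j
    obtain ⟨n, rfl⟩ := Nat.exists_eq_add_of_lt ht
    rw [zero_add] at *
    have hc : (ω (n + 1)).1.1 = true := hact.resolve_left n.succ_ne_zero
    have hlt := modGLR_lt_of_act_ne_halt 𝓑 (s := seeds (n + 1)) (hnone (n + 1))
    have hact' := piSMF_act_of_lt 𝓑 (est := est) (lam := lam) (γ := γ) (β := β) hlt
    have harm : arm (n + 1) = _ := congrArg Action.arm hact'
    rw [harm]
    simp only [Action.arm]
    rw [if_pos (by exact hc)]
    exact trackingArm_le (hξ (n + 1)) hex j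
  filter_upwards [hcoin, eventually_exploration_threshold K hb hbβ hβ hC hρ] with n hn hex i
  obtain ⟨r, s, hr, hrs, hsn⟩ := hex
  refine hr.trans ?_
  change (r : ℝ) ≤ sampleCount (π.arms ω n) i
  have hle : r ≤ ((Finset.range n).filter fun t => active t ∧ arm t = i).card := by
    refine le_card_of_greedy active arm r s ?_ n ?_ i
    · rintro t hact hst ⟨i, hi⟩
      simp only [← hcount] at hi ⊢
      rw [← hactive] at hst
      refine hgreedy t hact ?_ ⟨i, ?_⟩
      -- Time `0` counts as active but follows no forced exploration rule; it is excluded since it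
      -- has no active predecessors.
      · rcases Nat.eq_zero_or_pos t with rfl | h
        · rw [hactive] at hst
          simp at hst
        · exact h
      -- An arm with fewer than `r ≤ s ^ β - C` active samples is below the exploration threshold,
      -- because more than `s` active samples precede `t`.
      · have h1 : (activeCount (seeds t) (π.arms ω t) i : ℝ) < r := by exact_mod_cast hi
        have h2 : (s : ℝ) ^ β ≤ (((activeTimes (seeds t)).card + 1 : ℕ) : ℝ) ^ β := by
          refine Real.rpow_le_rpow (Nat.cast_nonneg _) ?_ (hb.trans hbβ).le
          exact_mod_cast hst.le.trans (Nat.le_succ _)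
        linarith
    · have h1 : ((s + 1 + K * r : ℕ) : ℝ) ≤
          (((Finset.range n).filter fun t => (ω t).1.1 = true).card : ℝ) := hsn.trans hn
      refine le_trans (by exact_mod_cast h1) (Finset.card_le_card ?_)
      exact Finset.monotone_filter_right _ fun t _ ht => Or.inr ht
  rw [← hcount] at hle
  exact_mod_cast hle.trans (activeCount_le_sampleCount _ _ _)

theorem seedLaw_coin (K M : ℕ) (γ : I) :
    (stageSeedLaw K M γ).real {s | s.1 = true} = γ := by
  have h : {s : StageSeed K M | s.1 = true} = {true} ×ˢ Set.univ := by
    ext s; simp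
  rw [h, stageSeedLaw, measureReal_prod_prod, probReal_univ, mul_one,
    ProbabilityTheory.bernoulliMeasure_real_apply_of_mem_of_notMem γ
      (measurableSet_singleton true) rfl (by simp)]

/-- On a path that never stops, the sample counts beat the noise and the true hypothesis eventually
crosses the threshold; the leader's statistic is at least as large, so the policy would have halted.
-/
theorem ae_decision_ne_none (hest : ∀ n a m, Measurable fun x => est n a x m)
    (hlam : Measurable lam) (hprior : 𝓑.IsProperPrior Υ n₀) {l : Fin M} {η : Param d}
    (hη : η ∈ 𝓑.Θ l) (hsep : ∀ m, m ≠ l → η ∉ closure (𝓑.Θ m)) (hL : 0 < (M - 1) * L)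
    (hγ : 0 < γ) (hβ : 1 / 2 < β) (hβ' : β < 1) :
    ∀ᵐ ω ∂(piSMF 𝓑 Υ n₀ est lam L γ β).prob 𝓑 η,
      (piSMF 𝓑 Υ n₀ est lam L γ β).decision ω ≠ none := by
  set π := piSMF 𝓑 Υ n₀ est lam L γ β with hπ
  have hηΨ := 𝓑.Θ_subset_naturalSpace l hη
  have hmeas : π.IsMeasurable := piSMF_isMeasurable 𝓑 Υ n₀ hest hlam L γ β
  -- Here `1/2 < β` is needed: it leaves room for `1/2 < θ < b < β`.
  obtain ⟨b, hb1, hb2⟩ := exists_between hβ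
  obtain ⟨θ, hθ1, hθ2⟩ := exists_between hb1
  have hγ' : (0 : ℝ) < γ := hγ
  filter_upwards [Policy.ae_likelihood_pos 𝓑 hηΨ, ae_eventually_norm_noise_le 𝓑 hmeas hηΨ hθ1,
    Policy.ae_forall_seed (π := π) 𝓑 hηΨ (ae_stageSeed_mem K M γ),
    Policy.ae_tendsto_frequency (π := π) 𝓑 hηΨ (f := fun s : StageSeed K M => s.1)
      measurable_fst] with ω hlik hnoise hties hfreq hnone
  rw [Policy.decision_eq_none_iff] at hnone
  have hfreq' : Tendsto (fun n : ℕ =>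
      (((Finset.range n).filter fun t => (ω t).1.1 = true).card : ℝ) / n) atTop (𝓝 (γ : ℝ)) := by
    rw [← seedLaw_coin K M γ]
    exact hfreq
  have hcoin : ∀ᶠ n : ℕ in atTop,
      (γ : ℝ) / 2 * n ≤ ((Finset.range n).filter fun t => (ω t).1.1 = true).card := by
    filter_upwards [hfreq'.eventually_const_le (half_lt_self hγ'), eventually_gt_atTop 0]
      with n hn hpos
    rwa [le_div_iff₀ (by exact_mod_cast hpos)] at hn
  have hcount := eventually_rpow_le_sampleCount 𝓑 hnone (fun t => (hties t).2) (half_pos hγ')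
    hcoin (by linarith : 0 < b) hb2 hβ'
  have hev := 𝓑.eventually_log_le_modGLR hprior hη hsep (π.arms ω) (π.obs ω)
    (by linarith : 0 < θ) hθ2 hlik hcount (hnoise hlik) hL
  obtain ⟨n, hn⟩ := eventually_atTop.1 hev
  have h1 := hn (n + 1) n.le_succ
  have h2 := modGLR_lt_of_act_ne_halt 𝓑 (s := fun t => (ω t).1) (hnone (n + 1))
  have h3 : 𝓑.modGLR Υ n₀ (π.arms ω (n + 1)) (π.obs ω (n + 1)) l ≤
      𝓑.modGLR Υ n₀ (π.arms ω (n + 1)) (π.obs ω (n + 1))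
        (leader 𝓑 Υ n₀ (fun t : Fin (n + 1 + 1) => (ω t).1) (π.arms ω (n + 1))
          (π.obs ω (n + 1))) :=
    mem_argmaxSet.1 ((hties (n + 1)).1 (argmaxSet (𝓑.modGLR Υ n₀ _ _))) l
  exact (h1.trans h3).not_gt h2

end NeverStops

end SMF

theorem proposition4 {K M : ℕ} [NeZero K] [NeZero M] (hM : 2 ≤ M) {d : Fin K → ℕ}
    (𝓑 : SMF.Problem K M d)
    (Υ : SMF.Param d) (n₀ : Fin K → ℝ) (hprior : 𝓑.IsProperPrior Υ n₀)
    (ε : ℕ → ℝ) (est : (n : ℕ) → (Fin n → Fin K) → (Fin n → ℝ) → Fin M → SMF.Param d)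
    (hest : 𝓑.IsMLE ε est)
    (lam : SMF.Param d → Fin K → ℝ) (hlam : 𝓑.IsOptimalSampling lam)
    (α : ℝ) (hα : 0 < α) (γ : unitInterval) (hγ : 0 < γ)
    (β : ℝ) (hβ : 1 / 2 < β) (hβ' : β < 1) :
    (∀ l, ∀ η ∈ 𝓑.Θ l,
      (SMF.piSMF 𝓑 Υ n₀ est lam (1 / α) γ β).prob 𝓑 η
        {ω | ∃ m, m ≠ l ∧
          (SMF.piSMF 𝓑 Υ n₀ est lam (1 / α) γ β).decision ω = some m} ≤ ENNReal.ofReal α) ∧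
    (𝓑.Separated →
      SMF.piSMF 𝓑 Υ n₀ est lam (1 / α) γ β ∈ SMF.Admissible 𝓑 α) := by
  have hwrong : ∀ l, ∀ η ∈ 𝓑.Θ l, _ := fun l η hη =>
    SMF.prob_wrong_decision_le 𝓑 (Υ := Υ) (n₀ := n₀) (γ := γ) (β := β) hM hest.measurable
      hlam.measurable hα hη
  refine ⟨hwrong, fun hsep => ⟨SMF.piSMF_isMeasurable 𝓑 Υ n₀ hest.measurable hlam.measurable _ γ β,
    fun l η hη => ?_⟩⟩
  have hL : 0 < ((M : ℝ) - 1) * (1 / α) := by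
    have : (2 : ℝ) ≤ M := by exact_mod_cast hM
    have : (0 : ℝ) < M - 1 := by linarith
    positivity
  -- Never stopping is a null event, so `δ ≠ l` is almost surely contained in a wrong declaration.
  refine le_trans (measure_mono_ae ?_) (hwrong l η hη)
  filter_upwards [SMF.ae_decision_ne_none 𝓑 hest.measurable hlam.measurable hprior hη
    (fun m hm => Set.disjoint_left.1 (hsep l m hm.symm) hη) hL hγ hβ hβ'] with ω hω hne
  obtain ⟨m, hm⟩ := Option.ne_none_iff_exists'.1 hω
  exact ⟨m, fun h => hne (h ▸ hm), hm⟩
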